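/- For a partition $\pi$ with different parts $n_1<n_2<\cdots<n_m$, let $f_j=f_j(\pi)$ be the number of times the part $n_j$ occurs in $\pi$ ($1\le j\le m$). For $k\ge 1$ define the weight $$ \omega_k(\pi)=\sum_{\substack{m_1+m_2+\cdots+m_r=k\\ 1\le r\le k}}\binom{f_1+m_1-1}{2m_1-1}\sum_{2\le j_2<j_3<\cdots<j_r\le m}\binom{f_{j_2}+m_2}{2m_2}\binom{f_{j_3}+m_3}{2m_3}\cdots\binom{f_{j_r}+m_r}{2m_r}, $$ where the outer sum is over all compositions of $k$ into positive integers $m_1,\dots,m_r$ (for $r=1$ the inner sum is $1$), and for the empty partition put $\omega_k=0$. Define the higher order spt-function by $$ \operatorname{spt}_k(n)=\sum_{\pi\vdash n}\omega_k(\pi), $$ the sum being over all partitions $\pi$ of $n$. Then for every integer $n\ge 0$, $$ \operatorname{spt}_4(3n)\equiv 0\pmod 3. $$ -/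

import Mathlib

namespace HigherSpt

/-- The frequency `f_j(π)` of the `j`-th smallest of the different parts of the partition `π`.
The different parts are indexed from `0`, so `freq π 0` is the number of smallest parts. -/
def freq {n : ℕ} (π : n.Partition) (j : Fin π.parts.toFinset.card) : ℕ :=
  π.parts.count (π.parts.toFinset.orderEmbOfFin rfl j)

/-- The weight `ω_k(π)`, for `k ≥ 1`: the sum over all compositions `m_1 + ⋯ + m_r` of `k` and
all increasing tuples `j_1 < j_2 < ⋯ < j_r` of indices of different parts of `π`, where `j_1` is
the index of the smallest part, of
`C(f_{j_1} + m_1 - 1, 2 m_1 - 1) * C(f_{j_2} + m_2, 2 m_2) * ⋯ * C(f_{j_r} + m_r, 2 m_r)`. -/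
def weight (k : ℕ) {n : ℕ} (π : n.Partition) : ℕ :=
  ∑ m : Composition k,
    ∑ j : Fin m.length → Fin π.parts.toFinset.card with
        (∀ a b : Fin m.length, a < b → j a < j b) ∧ (∀ i : Fin m.length, (i : ℕ) = 0 → (j i : ℕ) = 0),
      ∏ i : Fin m.length,
        if (i : ℕ) = 0 then (freq π (j i) + m.blocksFun i - 1).choose (2 * m.blocksFun i - 1)
        else (freq π (j i) + m.blocksFun i).choose (2 * m.blocksFun i)

/-- The higher order spt-function `spt_k(n)`, for `k ≥ 1`: the sum of `ω_k(π)` over all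
partitions `π` of `n`. -/
def spt (k n : ℕ) : ℕ := ∑ π : n.Partition, weight k π

end HigherSpt

/-! Let `x_m = q^m / (1 - q^m)^2`, let `F = ∏ 1 / (1 - q^m)`, and let `D = q d/dq`. It is enough to
show that, modulo 3, the generating function of `spt_4` is of the form `D G`, because `D` multiplies
the coefficient of `q^n` by `n`. All infinite sums and products are cut off at `N`, and identities
are read modulo `q^(N+1)`.

Marking the weight by a variable `u` turns the partition sum into `F ∑_a (q)_a x_a h_3(x_a, …, x_N)`
(`spt_eq_coeff`). Partial fractions in `u`, with residues `c_j`, and a terminating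
`q`-Chu-Vandermonde sum convert this to `F ∑_j c_j x_j^4 (1 - q^(j^2))` (`sum_qPoch_mul_hsymm`). The
first half of the sum is `h_4`. Modulo 3, `q^(j^2)` may be replaced by `c_j^2 x_j / (1 + x_j)`, so
the second half becomes `U_4`, where `U_k = ∑_j c_j^3 x_j^(k+1) / (1 + x_j)` (`modX_sum_res`).

In characteristic 3 the cubes `c_j^3` are constants for `D`, and the reciprocity between residues at
pairs of poles can be cubed termwise. This expresses `U_4 + U_3 + (D + p_1) U_3` and `U_2 + (D +
p_1) U_1` through the power sums `p_k` of the `x_m` (`modX_cubicSum_four`, `modX_cubicSum_two`),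
while `U_3 + U_2 = p_1^3`.

The elementary symmetric functions come from the Jacobi triple product: `(q)^3 e_k` is a theta
series whose coefficients satisfy a heat-type recurrence, which gives `D e_2 = D e_3 = 0` and `D p_1
= p_1 - e_2`. Since `D F = p_1 F`, Fermat's `D^3 = D` applied to `F` forces `e_2 = p_1^3`. As `D (F
G) = F (D + p_1) G`, these relations yield an explicit `G` (`modX_exists_eulerD`). -/

namespace HigherSpt

open Finset PowerSeries

/-! ### Partial fractions and reciprocity of residues. -/

section PartialFractions

variable {ι L : Type*} [DecidableEq ι] [Field L]

/-- The residue at `u = 1 / x j` in the partial fraction expansion of `∏ m ∈ s, 1 / (1 - u x m)`. -/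
def residue (x : ι → L) (s : Finset ι) (j : ι) : L := ∏ m ∈ s.erase j, x j / (x j - x m)

lemma residue_insert_of_mem (x : ι → L) {s : Finset ι} {b j : ι} (hb : b ∉ s) (hj : j ∈ s) :
    residue x (insert b s) j = residue x s j * (x j / (x j - x b)) := by
  have hne : b ≠ j := fun h => hb (h ▸ hj)
  rw [residue, erase_insert_of_ne hne, prod_insert (by simp [hb]), residue, mul_comm]

lemma residue_insert_self (x : ι → L) {s : Finset ι} {b : ι} (hb : b ∉ s) :
    residue x (insert b s) b = ∏ m ∈ s, x b / (x b - x m) := by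
  rw [residue, erase_insert hb]

/-- This is the partial fraction expansion at `u = 1 / v`. In the induction the residue at the new
pole `b` is itself the product at `v = x b`, so the hypothesis is used both at `v` and at `x b`. -/
lemma sum_residue_mul_div (x : ι → L) {s : Finset ι} (hs : s.Nonempty) (hx : Set.InjOn x s)
    {v : L} (hv : ∀ m ∈ s, v ≠ x m) :
    ∑ m ∈ s, residue x s m * (v / (v - x m)) = ∏ m ∈ s, v / (v - x m) := by
  induction hs using Finset.Nonempty.cons_induction generalizing v with
  | singleton a => simp [residue]
  | cons b s hb hs ih =>
    rw [cons_eq_insert] at hx hv ⊢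
    have hxs : Set.InjOn x s := hx.mono (by simp)
    have hbs : ∀ m ∈ s, x b ≠ x m := fun m hm h =>
      hb ((hx (by simp) (by simp [hm]) h) ▸ hm)
    have ihv := ih hxs (v := v) (fun m hm => hv m (by simp [hm]))
    have ihb := ih hxs (v := x b) hbs
    have hvb : v - x b ≠ 0 := sub_ne_zero.2 (hv b (by simp))
    rw [sum_insert hb, prod_insert hb, residue_insert_self x hb, ← ihv, ← ihb]
    have key : ∀ m ∈ s, residue x (insert b s) m * (v / (v - x m)) =
        v / (v - x b) * (residue x s m * (v / (v - x m)) -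
          residue x s m * (x b / (x b - x m))) := by
      intro m hm
      have h1 : v - x m ≠ 0 := sub_ne_zero.2 (hv m (by simp [hm]))
      have h2 : x b - x m ≠ 0 := sub_ne_zero.2 (hbs m hm)
      rw [residue_insert_of_mem x hb hm, ← neg_sub (x b) (x m), div_neg]
      field_simp
      ring
    rw [sum_congr rfl key, ← mul_sum, sum_sub_distrib]
    ring

/-- Formally this is `-v d/dv` of `sum_residue_mul_div`, the right side being a logarithmic
derivative. The induction avoids differentiating in a general field. -/
lemma sum_residue_mul_div_sq (x : ι → L) {s : Finset ι} (hs : s.Nonempty) (hx : Set.InjOn x s)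
    {v : L} (hv : ∀ m ∈ s, v ≠ x m) :
    ∑ m ∈ s, residue x s m * (v * x m / (v - x m) ^ 2) =
      (∏ m ∈ s, v / (v - x m)) * ∑ m ∈ s, x m / (v - x m) := by
  induction hs using Finset.Nonempty.cons_induction generalizing v with
  | singleton a =>
    have h1 : v - x a ≠ 0 := sub_ne_zero.2 (hv a (by simp))
    simp [residue]
    field_simp
  | cons b s hb hs ih =>
    rw [cons_eq_insert] at hx hv ⊢
    have hxs : Set.InjOn x s := hx.mono (by simp)
    have hbs : ∀ m ∈ s, x b ≠ x m := fun m hm h =>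
      hb ((hx (by simp) (by simp [hm]) h) ▸ hm)
    have ihv := ih hxs (v := v) (fun m hm => hv m (by simp [hm]))
    have hpv := sum_residue_mul_div x hs hxs (v := v) (fun m hm => hv m (by simp [hm]))
    have hpb := sum_residue_mul_div x hs hxs hbs
    have hvb : v - x b ≠ 0 := sub_ne_zero.2 (hv b (by simp))
    rw [sum_insert hb, sum_insert hb, prod_insert hb, residue_insert_self x hb, ← hpb]
    have key : ∀ m ∈ s, residue x (insert b s) m * (v * x m / (v - x m) ^ 2) =
        v / (v - x b) * (residue x s m * (v * x m / (v - x m) ^ 2)) +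
        x b * v / (v - x b) ^ 2 * (residue x s m * (v / (v - x m)) -
          residue x s m * (x b / (x b - x m))) := by
      intro m hm
      have h1 : v - x m ≠ 0 := sub_ne_zero.2 (hv m (by simp [hm]))
      have h2 : x b - x m ≠ 0 := sub_ne_zero.2 (hbs m hm)
      rw [residue_insert_of_mem x hb hm, ← neg_sub (x b) (x m), div_neg]
      field_simp
      ring
    rw [sum_congr rfl key, sum_add_distrib, ← mul_sum, ← mul_sum, sum_sub_distrib, ihv, hpv, hpb]
    field_simp
    ring

lemma sum_residue (x : ι → L) {s : Finset ι} (hs : s.Nonempty) (hx : Set.InjOn x s) :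
    ∑ m ∈ s, residue x s m = 1 := by
  induction hs using Finset.Nonempty.cons_induction with
  | singleton a => simp [residue]
  | cons b s hb hs ih =>
    rw [cons_eq_insert] at hx ⊢
    have hxs : Set.InjOn x s := hx.mono (by simp)
    have hbs : ∀ m ∈ s, x b ≠ x m := fun m hm h =>
      hb ((hx (by simp) (by simp [hm]) h) ▸ hm)
    rw [sum_insert hb, residue_insert_self x hb, ← sum_residue_mul_div x hs hxs hbs,
      ← sum_add_distrib, ← ih hxs]
    refine sum_congr rfl fun m hm => ?_
    have h2 : x b - x m ≠ 0 := sub_ne_zero.2 (hbs m hm)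
    rw [residue_insert_of_mem x hb hm, ← neg_sub (x b) (x m), div_neg]
    field_simp
    ring

/-- The reciprocity between residues at pairs of poles. -/
lemma sum_residue_reciprocity (x : ι → L) {s : Finset ι} (hx : Set.InjOn x s) {a : ι}
    (ha : a ∈ s) :
    ∑ m ∈ s.erase a, residue x s m * (x a / (x m - x a)) =
      ∑ m ∈ s.erase a, residue x s a * (x m / (x a - x m)) := by
  -- With `t = s \ {a}`, the two sides are those of `sum_residue_mul_div_sq` for `t` at `v = x a`.
  obtain ⟨t, hat, rfl⟩ : ∃ t, a ∉ t ∧ s = insert a t := ⟨s.erase a, by simp, by simp [ha]⟩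
  rw [erase_insert hat]
  have hbs : ∀ m ∈ t, x a ≠ x m := fun m hm h =>
      hat ((hx (by simp) (by simp [hm]) h) ▸ hm)
  rcases t.eq_empty_or_nonempty with rfl | ht
  · simp
  rw [← mul_sum, residue_insert_self x hat,
    ← sum_residue_mul_div_sq x ht (hx.mono (by simp)) hbs]
  refine sum_congr rfl fun m hm => ?_
  have h2 : x a - x m ≠ 0 := sub_ne_zero.2 (hbs m hm)
  rw [residue_insert_of_mem x hat hm, ← neg_sub (x a) (x m), div_neg, div_neg]
  field_simp

end PartialFractions

/-! ### Complete and elementary symmetric functions as power series coefficients. -/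

section Symmetric

variable {ι R : Type*} [CommRing R]

/-- The series `1 / (1 - a u)`. -/
def geom (a : R) : R⟦X⟧ := PowerSeries.mk fun n => a ^ n

@[simp] lemma coeff_geom (a : R) (n : ℕ) : coeff n (geom a) = a ^ n := by simp [geom]

lemma geom_mul (a : R) : geom a * (1 - C a * X) = 1 := by
  ext n
  rcases n with - | n
  · simp [geom]
  · rw [mul_sub, mul_one, ← mul_assoc, map_sub, coeff_succ_mul_X, coeff_mul_C]
    simp [coeff_one, pow_succ]

/-- The complete homogeneous symmetric function of degree `k` of the `x m`, `m ∈ s`. -/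
noncomputable def hsymm (x : ι → R) (s : Finset ι) (k : ℕ) : R := coeff k (∏ m ∈ s, geom (x m))

/-- The elementary symmetric function of degree `k` of the `x m`, `m ∈ s`, up to the sign
`(-1) ^ k`. -/
noncomputable def signedEsymm (x : ι → R) (s : Finset ι) (k : ℕ) : R := coeff k (∏ m ∈ s, (1 - C (x m) * X))

lemma hsymm_insert [DecidableEq ι] (x : ι → R) {s : Finset ι} {b : ι} (hb : b ∉ s) (k : ℕ) :
    hsymm x (insert b s) (k + 1) = hsymm x s (k + 1) + x b * hsymm x (insert b s) k := by
  have h : ∏ m ∈ s, geom (x m) = (∏ m ∈ insert b s, geom (x m)) * (1 - C (x b) * X) := by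
    rw [prod_insert hb, mul_right_comm, geom_mul, one_mul]
  rw [hsymm, hsymm, hsymm, h, mul_sub, mul_one, ← mul_assoc, map_sub, coeff_succ_mul_X,
    coeff_mul_C]
  ring

lemma hsymm_zero (x : ι → R) (s : Finset ι) : hsymm x s 0 = 1 := by
  simp [hsymm, coeff_zero_eq_constantCoeff, map_prod, geom, constantCoeff_mk]

lemma hsymm_mul_esymm (x : ι → R) (s : Finset ι) :
    (∏ m ∈ s, geom (x m)) * ∏ m ∈ s, (1 - C (x m) * X) = 1 := by
  rw [← prod_mul_distrib]
  exact prod_eq_one fun m _ => geom_mul _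

lemma derivative_prod_geom (x : ι → R) (s : Finset ι) :
    derivative R (∏ m ∈ s, geom (x m)) =
      (∏ m ∈ s, geom (x m)) * PowerSeries.mk fun n => ∑ m ∈ s, x m ^ (n + 1) := by
  classical
  have hg : ∀ a : R, derivative R (geom a) = geom a * PowerSeries.mk fun n => a ^ (n + 1) := by
    intro a
    ext n
    rw [coeff_derivative, coeff_mul, coeff_geom]
    simp only [coeff_geom, coeff_mk]
    rw [Finset.sum_congr rfl (g := fun _ => a ^ (n + 1)) fun p hp => ?_]
    · simp [mul_comm]
    · rw [HasAntidiagonal.mem_antidiagonal] at hp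
      rw [← pow_add, ← add_assoc, hp]
  induction s using Finset.induction_on with
  | empty =>
    simp only [prod_empty, sum_empty, derivative_one]
    ext n
    simp
  | insert b s hb ih =>
    rw [prod_insert hb, Derivation.leibniz, ih, hg]
    have h : (PowerSeries.mk fun n => ∑ m ∈ insert b s, x m ^ (n + 1)) =
        (PowerSeries.mk fun n => x b ^ (n + 1)) +
          PowerSeries.mk fun n => ∑ m ∈ s, x m ^ (n + 1) := by
      ext n
      simp [sum_insert hb]
    rw [h, smul_eq_mul, smul_eq_mul]
    ring

/-- Newton's identities for the complete homogeneous symmetric functions. -/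
lemma newton_hsymm (x : ι → R) (s : Finset ι) (n : ℕ) :
    hsymm x s (n + 1) * (n + 1) =
      ∑ i ∈ range (n + 1), hsymm x s i * ∑ m ∈ s, x m ^ (n - i + 1) := by
  have h := congrArg (coeff n) (derivative_prod_geom x s)
  rw [coeff_derivative, coeff_mul, Finset.Nat.sum_antidiagonal_eq_sum_range_succ_mk] at h
  simpa only [coeff_mk, hsymm] using h

lemma hsymm_one (x : ι → R) (s : Finset ι) : hsymm x s 1 = ∑ m ∈ s, x m := by
  have h := newton_hsymm x s 0
  simpa [hsymm_zero] using h

lemma sum_hsymm_mul_signedEsymm (x : ι → R) (s : Finset ι) (n : ℕ) :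
    ∑ i ∈ range (n + 2), hsymm x s i * signedEsymm x s (n + 1 - i) = 0 := by
  have h := congrArg (coeff (n + 1)) (hsymm_mul_esymm x s)
  rw [coeff_mul, Finset.Nat.sum_antidiagonal_eq_sum_range_succ_mk, coeff_one] at h
  simpa [hsymm, signedEsymm] using h

lemma signedEsymm_zero (x : ι → R) (s : Finset ι) : signedEsymm x s 0 = 1 := by
  simp [signedEsymm, coeff_zero_eq_constantCoeff, map_prod]

end Symmetric

/-- These are the coefficients of `u ^ k` in the partial fraction expansion. -/
lemma sum_residue_mul_pow {ι L : Type*} [DecidableEq ι] [Field L] (x : ι → L) {s : Finset ι}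
    (hs : s.Nonempty) (hx : Set.InjOn x s) (k : ℕ) :
    ∑ m ∈ s, residue x s m * x m ^ k = hsymm x s k := by
  induction hs using Finset.Nonempty.cons_induction generalizing k with
  | singleton a => simp [residue, hsymm]
  | cons b s hb hs ih =>
    rw [cons_eq_insert] at hx ⊢
    have hxs : Set.InjOn x s := hx.mono (by simp)
    have hbs : ∀ m ∈ s, x b ≠ x m := fun m hm h =>
      hb ((hx (by simp) (by simp [hm]) h) ▸ hm)
    induction k with
    | zero => simp [hsymm_zero, sum_residue x (insert_nonempty b s) hx]
    | succ k ihk =>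
      rw [hsymm_insert x hb, ← ih hxs, ← ihk, sum_insert hb, sum_insert hb, mul_add, mul_sum,
        add_left_comm, ← sum_add_distrib, pow_succ']
      congr 1
      · ring
      refine sum_congr rfl fun m hm => ?_
      have h2 : x m - x b ≠ 0 := sub_ne_zero.2 (hbs m hm).symm
      rw [residue_insert_of_mem x hb hm]
      field_simp
      ring

end HigherSpt

/-! ### The `q`-series identities over a field in which `q` is not a root of unity. -/

namespace HigherSpt

open Finset

section QField

variable {L : Type*} [Field L]

/-- The term `q ^ m / (1 - q ^ m) ^ 2` of the Lambert series of the divisor sums. -/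
def lambert (q : L) (m : ℕ) : L := q ^ m / (1 - q ^ m) ^ 2

/-- The shifted factorial `(1 - a) (1 - a q) ⋯ (1 - a q ^ (n - 1))`. -/
def qPoch {R : Type*} [CommRing R] (q a : R) (n : ℕ) : R := ∏ i ∈ range n, (1 - a * q ^ i)

lemma qPoch_succ {R : Type*} [CommRing R] (q a : R) (n : ℕ) :
    qPoch q a (n + 1) = qPoch q a n * (1 - a * q ^ n) := by
  simp [qPoch, prod_range_succ]

lemma qPoch_succ' {R : Type*} [CommRing R] (q a : R) (n : ℕ) :
    qPoch q a (n + 1) = (1 - a) * qPoch q (a * q) n := by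
  simp only [qPoch, prod_range_succ', pow_zero, mul_one]
  rw [mul_comm]
  congr 1
  exact prod_congr rfl fun i _ => by ring

lemma qPoch_self_ne_zero {q : L} (hq : ∀ m : ℕ, m ≠ 0 → q ^ m ≠ 1) (n : ℕ) :
    qPoch q q n ≠ 0 := by
  refine prod_ne_zero_iff.2 fun i _ => ?_
  rw [← pow_succ', sub_ne_zero]
  exact (hq _ (by omega)).symm

/-- A terminating `q`-Chu-Vandermonde sum. -/
lemma sum_qPoch_mul {q : L} (hq0 : q ≠ 0) (hq : ∀ m : ℕ, m ≠ 0 → q ^ m ≠ 1) (j : ℕ) (b : L)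
    {M : ℕ} (hM : j < M) :
    ∑ n ∈ range M, qPoch q (q ^ j)⁻¹ n * qPoch q b n * q ^ n / qPoch q q n = b ^ j := by
  induction j generalizing b M with
  | zero =>
    obtain ⟨M, rfl⟩ := Nat.exists_eq_add_of_lt hM
    rw [zero_add, sum_range_succ', sum_eq_zero fun n _ => ?_]
    · simp [qPoch]
    · simp [qPoch_succ']
  | succ j ih =>
    obtain ⟨M, rfl⟩ : ∃ K, M = K + 1 := ⟨M - 1, by omega⟩
    have h1 := ih b (M := M + 1) (by omega)
    have h2 := ih (b * q) (M := M) (by omega)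
    -- Each term for `j + 1` is the term for `j` minus a shifted term with `b q` in place of `b`.
    -- The induction hypothesis sums both, and `b ^ j - (1 - b) * b ^ j = b ^ (j + 1)`.
    have key : ∀ n, qPoch q (q ^ (j + 1))⁻¹ (n + 1) * qPoch q b (n + 1) * q ^ (n + 1) /
        qPoch q q (n + 1) = qPoch q (q ^ j)⁻¹ (n + 1) * qPoch q b (n + 1) * q ^ (n + 1) /
        qPoch q q (n + 1) - (q ^ j)⁻¹ * (1 - b) *
          (qPoch q (q ^ j)⁻¹ n * qPoch q (b * q) n * q ^ n / qPoch q q n) := by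
      intro n
      have e1 : qPoch q (q ^ (j + 1))⁻¹ (n + 1) = (1 - (q ^ (j + 1))⁻¹) * qPoch q (q ^ j)⁻¹ n := by
        rw [qPoch_succ', pow_succ, mul_inv, inv_mul_cancel_right₀ hq0]
      have e2 : (1 - q * q ^ n) ≠ 0 := by
        rw [← pow_succ', sub_ne_zero]
        exact (hq _ (by omega)).symm
      have e3 := qPoch_self_ne_zero hq n
      rw [e1, qPoch_succ q (q ^ j)⁻¹ n, qPoch_succ q q n, qPoch_succ' q b n]
      field_simp
      ring
    rw [sum_range_succ', sum_congr rfl fun n _ => key n, sum_sub_distrib, ← mul_sum, h2]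
    rw [sum_range_succ'] at h1
    have e4 : (q ^ j)⁻¹ * (1 - b) * (b * q) ^ j = (1 - b) * b ^ j := by
      rw [mul_pow]
      field_simp
    rw [e4]
    simp only [qPoch, range_zero, prod_empty] at h1 ⊢
    linear_combination h1

/-- This factorization turns products of differences of Lambert terms into shifted factorials. -/
lemma one_sub_lambert_div {q : L} (hq0 : q ≠ 0) (hq : ∀ m : ℕ, m ≠ 0 → q ^ m ≠ 1) {j m : ℕ}
    (hj : j ≠ 0) (hm : m ≠ 0) :
    1 - lambert q m / lambert q j =
      (1 - (q ^ j)⁻¹ * q ^ m) * (1 - q ^ j * q ^ m) / (1 - q ^ m) ^ 2 := by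
  have h1 : 1 - q ^ j ≠ 0 := sub_ne_zero.2 (hq j hj).symm
  have h2 : 1 - q ^ m ≠ 0 := sub_ne_zero.2 (hq m hm).symm
  unfold lambert
  field_simp
  ring

lemma lambert_ne_zero {q : L} (hq0 : q ≠ 0) (hq : ∀ m : ℕ, m ≠ 0 → q ^ m ≠ 1) {j : ℕ}
    (hj : j ≠ 0) : lambert q j ≠ 0 :=
  div_ne_zero (pow_ne_zero _ hq0) (pow_ne_zero _ (sub_ne_zero.2 (hq j hj).symm))

lemma pow_ne_pow_of_ne {q : L} (hq0 : q ≠ 0) (hq : ∀ m : ℕ, m ≠ 0 → q ^ m ≠ 1) {j m : ℕ}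
    (h : j ≠ m) : q ^ j ≠ q ^ m := by
  wlog hlt : j < m generalizing j m
  · exact (this h.symm (by omega)).symm
  obtain ⟨d, rfl⟩ := Nat.exists_eq_add_of_lt hlt
  intro he
  refine hq (d + 1) (by omega) (mul_left_cancel₀ (pow_ne_zero j hq0) ?_)
  rw [← pow_add, mul_one, ← add_assoc, ← he]

lemma one_sub_inv_mul_ne_zero {q : L} (hq0 : q ≠ 0) (hq : ∀ m : ℕ, m ≠ 0 → q ^ m ≠ 1) {j m : ℕ}
    (h : j ≠ m) : 1 - (q ^ j)⁻¹ * q ^ m ≠ 0 := by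
  have := pow_ne_zero j hq0
  rw [sub_ne_zero]
  intro he
  apply pow_ne_pow_of_ne hq0 hq h
  field_simp at he
  exact he

lemma one_sub_mul_ne_zero {q : L} (hq : ∀ m : ℕ, m ≠ 0 → q ^ m ≠ 1) {j m : ℕ}
    (h : j ≠ 0) : 1 - q ^ j * q ^ m ≠ 0 := by
  rw [sub_ne_zero, ← pow_add]
  exact (hq _ (by omega)).symm

lemma lambert_sub_ne_zero {q : L} (hq0 : q ≠ 0) (hq : ∀ m : ℕ, m ≠ 0 → q ^ m ≠ 1) {j m : ℕ}
    (hj : j ≠ 0) (hm : m ≠ 0) (h : j ≠ m) : lambert q j - lambert q m ≠ 0 := by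
  have h0 := lambert_ne_zero hq0 hq hj
  have h1 := one_sub_lambert_div hq0 hq hj hm
  intro he
  rw [sub_eq_zero] at he
  rw [← he, div_self h0, sub_self, eq_comm, div_eq_zero_iff] at h1
  rcases h1 with h1 | h1
  · exact mul_ne_zero (one_sub_inv_mul_ne_zero hq0 hq h) (one_sub_mul_ne_zero hq hj) h1
  · exact pow_ne_zero 2 (sub_ne_zero.2 (hq m hm).symm) h1

lemma lambert_injOn {q : L} (hq0 : q ≠ 0) (hq : ∀ m : ℕ, m ≠ 0 → q ^ m ≠ 1) {s : Finset ℕ}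
    (hs : 0 ∉ s) : Set.InjOn (lambert q) s := by
  intro a ha b hb hab
  by_contra hne
  exact lambert_sub_ne_zero hq0 hq (fun h => hs (h ▸ ha)) (fun h => hs (h ▸ hb)) hne
    (sub_eq_zero.2 hab)

lemma lambert_div_sub {q : L} (hq0 : q ≠ 0) (hq : ∀ m : ℕ, m ≠ 0 → q ^ m ≠ 1) {j m : ℕ}
    (hj : j ≠ 0) (hm : m ≠ 0) :
    lambert q j / (lambert q j - lambert q m) =
      (1 - q ^ m) ^ 2 / ((1 - (q ^ j)⁻¹ * q ^ m) * (1 - q ^ j * q ^ m)) := by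
  have h0 := lambert_ne_zero hq0 hq hj
  have h1 := one_sub_lambert_div hq0 hq hj hm
  rw [← inv_inj, inv_div, inv_div, ← h1, sub_div, div_self h0]

/-- The summand is minus the `n`-th summand of `sum_qPoch_mul` with `b = q ^ j`. The absent term `n
= 0` supplies the `1`, and `b ^ j = q ^ j ^ 2`. -/
lemma sum_qPoch_mul_lambert {q : L} (hq0 : q ≠ 0) (hq : ∀ m : ℕ, m ≠ 0 → q ^ m ≠ 1) {j : ℕ}
    (hj : j ≠ 0) :
    ∑ n ∈ Icc 1 j, qPoch q q n * (lambert q n / lambert q j) *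
      ∏ m ∈ Ico 1 n, (1 - lambert q m / lambert q j) = 1 - q ^ j ^ 2 := by
  have hvan := sum_qPoch_mul hq0 hq j (q ^ j) (Nat.lt_succ_self j)
  rw [Nat.succ_eq_add_one, sum_range_succ', ← pow_mul, ← sq] at hvan
  rw [← hvan]
  have hr : Icc 1 j = (range j).map (addRightEmbedding 1) := by
    ext a
    simp only [mem_Icc, mem_map, mem_range, addRightEmbedding_apply]
    exact ⟨fun h => ⟨a - 1, by omega, by omega⟩, by rintro ⟨b, h, rfl⟩; omega⟩
  rw [hr, sum_map]
  have key : ∀ n, qPoch q q (n + 1) * (lambert q (n + 1) / lambert q j) *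
      ∏ m ∈ Ico 1 (n + 1), (1 - lambert q m / lambert q j) =
      -(qPoch q (q ^ j)⁻¹ (n + 1) * qPoch q (q ^ j) (n + 1) * q ^ (n + 1) /
        qPoch q q (n + 1)) := by
    intro n
    have e0 : qPoch q q n ≠ 0 := qPoch_self_ne_zero hq n
    have hp : ∏ m ∈ Ico 1 (n + 1), (1 - lambert q m / lambert q j) =
        qPoch q ((q ^ j)⁻¹ * q) n * qPoch q (q ^ j * q) n / qPoch q q n ^ 2 := by
      rw [prod_Ico_eq_prod_range, Nat.add_sub_cancel]
      simp only [qPoch, ← prod_mul_distrib, ← prod_pow, ← prod_div_distrib]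
      refine prod_congr rfl fun i _ => ?_
      rw [one_sub_lambert_div hq0 hq hj (by omega)]
      ring_nf
    have e1 : 1 - q * q ^ n ≠ 0 := by
      rw [sub_ne_zero, ← pow_succ']
      exact (hq _ (by omega)).symm
    have e2 : 1 - q ^ j ≠ 0 := sub_ne_zero.2 (hq j hj).symm
    rw [hp, qPoch_succ' q (q ^ j)⁻¹, qPoch_succ' q (q ^ j), qPoch_succ q q n, lambert, lambert,
      pow_succ']
    field_simp
    ring
  simp only [addRightEmbedding_apply]
  rw [sum_congr rfl fun n _ => key n, sum_neg_distrib]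
  simp [qPoch]

lemma residue_Icc {q : L} (hq0 : q ≠ 0) (hq : ∀ m : ℕ, m ≠ 0 → q ^ m ≠ 1) {j n N : ℕ}
    (hn : 1 ≤ n) (hj : n ≤ j) (hjN : j ≤ N) :
    residue (lambert q) (Icc n N) j =
      residue (lambert q) (Icc 1 N) j * ∏ m ∈ Ico 1 n, (1 - lambert q m / lambert q j) := by
  have hsplit : (Icc 1 N).erase j = Ico 1 n ∪ (Icc n N).erase j := by
    ext a
    simp only [mem_erase, mem_Icc, mem_union, mem_Ico]
    omega
  have hdisj : Disjoint (Ico 1 n) ((Icc n N).erase j) := by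
    rw [disjoint_left]
    intro a ha hb
    simp only [mem_erase, mem_Icc, mem_Ico] at ha hb
    omega
  rw [eq_comm, residue, residue, hsplit, prod_union hdisj, mul_right_comm, ← prod_mul_distrib,
    prod_eq_one fun m hm => ?_, one_mul]
  rw [mem_Ico] at hm
  have h0 := lambert_ne_zero hq0 hq (j := j) (by omega)
  have h1 := lambert_sub_ne_zero hq0 hq (j := j) (m := m) (by omega) (by omega) (by omega)
  field_simp

/-- The Lambert series form of the generating function of the higher order spt-function. -/
lemma sum_qPoch_mul_hsymm {q : L} (hq0 : q ≠ 0) (hq : ∀ m : ℕ, m ≠ 0 → q ^ m ≠ 1) (k N : ℕ) :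
    ∑ n ∈ Icc 1 N, qPoch q q n * lambert q n * hsymm (lambert q) (Icc n N) k =
      ∑ j ∈ Icc 1 N, residue (lambert q) (Icc 1 N) j * lambert q j ^ (k + 1) *
        (1 - q ^ j ^ 2) := by
  have h1 : ∀ n ∈ Icc 1 N, qPoch q q n * lambert q n * hsymm (lambert q) (Icc n N) k =
      ∑ j ∈ Icc n N, residue (lambert q) (Icc 1 N) j * lambert q j ^ (k + 1) *
        (qPoch q q n * (lambert q n / lambert q j) *
          ∏ m ∈ Ico 1 n, (1 - lambert q m / lambert q j)) := by
    intro n hn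
    rw [mem_Icc] at hn
    rw [← sum_residue_mul_pow (lambert q) (nonempty_Icc.2 hn.2)
      (lambert_injOn hq0 hq (by simp; omega)), mul_sum]
    refine sum_congr rfl fun j hj => ?_
    rw [mem_Icc] at hj
    rw [residue_Icc hq0 hq hn.1 hj.1 hj.2]
    have h0 := lambert_ne_zero hq0 hq (j := j) (by omega)
    generalize ∏ m ∈ Ico 1 n, (1 - lambert q m / lambert q j) = P
    field_simp
    ring
  -- After the interchange, the inner sum over `n ≤ j` is evaluated by `sum_qPoch_mul_lambert`.
  rw [sum_congr rfl h1, sum_comm' (t' := Icc 1 N) (s' := fun j => Icc 1 j)]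
  · refine sum_congr rfl fun j hj => ?_
    rw [mem_Icc] at hj
    rw [← mul_sum, sum_qPoch_mul_lambert hq0 hq (by omega)]
  · intro a b
    simp only [mem_Icc]
    omega

lemma prod_one_sub_inv_mul {q : L} (hq0 : q ≠ 0) (j : ℕ) :
    ∏ m ∈ Ico 1 (j + 1), (1 - (q ^ (j + 1))⁻¹ * q ^ m) =
      ∏ i ∈ range j, (1 - (q ^ (i + 1))⁻¹) := by
  rw [prod_Ico_eq_prod_range, Nat.add_sub_cancel, ← prod_range_reflect]
  refine prod_congr rfl fun i hi => ?_
  rw [mem_range] at hi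
  congr 1
  rw [inv_mul_eq_div, ← one_div, div_eq_div_iff (pow_ne_zero _ hq0) (pow_ne_zero _ hq0),
    ← pow_add, one_mul]
  congr 1
  omega

lemma prod_one_sub_inv_mul_sq {q : L} (hq0 : q ≠ 0) (j : ℕ) :
    (∏ i ∈ range j, (1 - (q ^ (i + 1))⁻¹)) ^ 2 * q ^ (j * (j + 1)) = qPoch q q j ^ 2 := by
  induction j with
  | zero => simp [qPoch]
  | succ j ih =>
    have h2 : q ^ ((j + 1) * (j + 1 + 1)) = q ^ (j * (j + 1)) * (q ^ (j + 1)) ^ 2 := by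
      rw [← pow_mul, ← pow_add]
      ring_nf
    rw [prod_range_succ, qPoch_succ, mul_pow, mul_pow, ← ih, h2, ← pow_succ']
    have h3 : (1 - (q ^ (j + 1))⁻¹) ^ 2 * (q ^ (j + 1)) ^ 2 = (1 - q ^ (j + 1)) ^ 2 := by
      rw [← mul_pow, sub_mul, inv_mul_cancel₀ (pow_ne_zero _ hq0)]
      ring
    linear_combination (∏ x ∈ range j, (1 - (q ^ (x + 1))⁻¹)) ^ 2 * q ^ (j * (j + 1)) * h3

/-- The residue itself is `(-1)^(j-1) q^(j(j-1)/2) (1 + q^j) (q)_N^2 / ((q)_(N-j) (q)_(N+j))` with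
`N = j + t`. Only its square is needed, and squaring removes the sign and the halved exponent. The
induction on `t` adds one pole at a time. -/
lemma residue_lambert_sq {q : L} (hq0 : q ≠ 0) (hq : ∀ m : ℕ, m ≠ 0 → q ^ m ≠ 1) {j : ℕ}
    (hj : j ≠ 0) (t : ℕ) :
    residue (lambert q) (Icc 1 (j + t)) j ^ 2 * (qPoch q q t * qPoch q q (j + t + j)) ^ 2 =
      q ^ (j * (j - 1)) * (1 + q ^ j) ^ 2 * qPoch q q (j + t) ^ 4 := by
  induction t with
  | zero =>
    obtain ⟨i, rfl⟩ := Nat.exists_eq_succ_of_ne_zero hj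
    rw [Nat.succ_eq_add_one]
    have h1 : (Icc 1 (i + 1 + 0)).erase (i + 1) = Ico 1 (i + 1) := by
      ext a
      simp only [mem_erase, mem_Icc, mem_Ico]
      omega
    have h2 : qPoch q q (i + 1 + 0 + (i + 1)) =
        qPoch q q (i + 1) * (∏ m ∈ Ico 1 (i + 1), (1 - q ^ (i + 1) * q ^ m)) *
          (1 - q ^ (i + 1) * q ^ (i + 1)) := by
      rw [qPoch, add_zero, prod_range_add, ← qPoch,
        prod_range_succ (fun k => 1 - q * q ^ (i + 1 + k)) i, prod_Ico_eq_prod_range, mul_assoc,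
        Nat.add_sub_cancel]
      have e1 : ∀ k, q * q ^ (i + 1 + k) = q ^ (i + 1) * q ^ (1 + k) := fun k => by ring
      simp only [e1, add_comm 1 i]
    have h3 : ∏ m ∈ Ico 1 (i + 1), (1 - q ^ m) = qPoch q q i := by
      rw [prod_Ico_eq_prod_range, Nat.add_sub_cancel, qPoch]
      exact prod_congr rfl fun k _ => by ring
    have h4 := prod_one_sub_inv_mul_sq hq0 i
    rw [← prod_one_sub_inv_mul hq0] at h4
    have h5 : residue (lambert q) (Icc 1 (i + 1 + 0)) (i + 1) = qPoch q q i ^ 2 /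
        ((∏ m ∈ Ico 1 (i + 1), (1 - (q ^ (i + 1))⁻¹ * q ^ m)) *
          ∏ m ∈ Ico 1 (i + 1), (1 - q ^ (i + 1) * q ^ m)) := by
      rw [residue, h1, ← h3, ← prod_pow, ← prod_mul_distrib, ← prod_div_distrib]
      refine prod_congr rfl fun m hm => ?_
      rw [mem_Ico] at hm
      exact lambert_div_sub hq0 hq (by omega) (by omega)
    have e1 : ∏ m ∈ Ico 1 (i + 1), (1 - (q ^ (i + 1))⁻¹ * q ^ m) ≠ 0 :=
      prod_ne_zero_iff.2 fun m hm => one_sub_inv_mul_ne_zero hq0 hq (by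
        rw [mem_Ico] at hm; omega)
    have e2 : ∏ m ∈ Ico 1 (i + 1), (1 - q ^ (i + 1) * q ^ m) ≠ 0 :=
      prod_ne_zero_iff.2 fun m hm => one_sub_mul_ne_zero hq (by omega)
    rw [h5, h2, add_zero, qPoch_succ, Nat.add_sub_cancel, mul_comm (i + 1) i]
    have e3 : q * q ^ i = q ^ (i + 1) := by ring
    rw [e3]
    generalize (∏ m ∈ Ico 1 (i + 1), (1 - (q ^ (i + 1))⁻¹ * q ^ m)) = P at *
    generalize (∏ m ∈ Ico 1 (i + 1), (1 - q ^ (i + 1) * q ^ m)) = Q at *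
    generalize qPoch q q i = W at *
    have e4 : qPoch q q 0 = 1 := by simp [qPoch]
    rw [e4]
    generalize q ^ (i * (i + 1)) = B at *
    field_simp
    linear_combination (-(W ^ 4 * (1 - q ^ (i + 1)) ^ 4 * (1 + q ^ (i + 1)) ^ 2)) * h4
  | succ t ih =>
    have h1 : Icc 1 (j + (t + 1)) = insert (j + t + 1) (Icc 1 (j + t)) := by
      ext a
      simp only [mem_insert, mem_Icc]
      omega
    have e1 := one_sub_inv_mul_ne_zero hq0 hq (j := j) (m := j + t + 1) (by omega)
    have e2 := one_sub_mul_ne_zero hq (j := j) (m := j + t + 1) hj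
    rw [h1, residue_insert_of_mem _ (by simp) (by simp; omega),
      lambert_div_sub hq0 hq hj (by omega), qPoch_succ, ← add_assoc j t 1,
      qPoch_succ q q (j + t), show j + t + 1 + j = j + t + j + 1 by ring, qPoch_succ q q (j + t + j)]
    have e3 : 1 - q * q ^ t = 1 - (q ^ j)⁻¹ * q ^ (j + t + 1) := by
      have := pow_ne_zero j hq0
      rw [pow_add, pow_add]
      field_simp
    have e4 : q * q ^ (j + t + j) = q ^ j * q ^ (j + t + 1) := by ring
    have e5 : q * q ^ (j + t) = q ^ (j + t + 1) := by ring
    rw [e3, e4, e5]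
    generalize 1 - (q ^ j)⁻¹ * q ^ (j + t + 1) = P at *
    generalize 1 - q ^ j * q ^ (j + t + 1) = Q at *
    field_simp
    linear_combination (1 - q ^ (j + t + 1)) ^ 4 * ih

end QField

end HigherSpt

/-! ### Residues as power series modulo 3, and the cubed reciprocity. -/

namespace HigherSpt

open Finset PowerSeries

lemma map_hsymm {ι R S : Type*} [CommRing R] [CommRing S] (f : R →+* S) (x : ι → R)
    (s : Finset ι) (k : ℕ) : f (hsymm x s k) = hsymm (fun i => f (x i)) s k := by
  rw [hsymm, hsymm, ← PowerSeries.coeff_map, map_prod]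
  congr 2
  ext m n
  simp

lemma three_eq_zero : (3 : (ZMod 3)⟦X⟧) = 0 := by
  have h : (3 : ZMod 3) = 0 := by decide
  rw [← map_ofNat (C (R := ZMod 3)) 3, h, map_zero]

instance : CharP (ZMod 3)⟦X⟧ 3 := charP_of_injective_ringHom (C_injective (R := ZMod 3)) 3

/-- The series `1 / (1 - q ^ r)`. -/
noncomputable def geomQ (r : ℕ) : (ZMod 3)⟦X⟧ := (1 - X ^ r)⁻¹

/-- The series `q ^ m / (1 - q ^ m) ^ 2`. -/
noncomputable def lam (m : ℕ) : (ZMod 3)⟦X⟧ := X ^ m * geomQ m ^ 2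

lemma geomQ_mul {r : ℕ} (hr : r ≠ 0) : geomQ r * (1 - X ^ r) = 1 :=
  PowerSeries.inv_mul_cancel _ (by simp [hr])

/-- The series `(1 - q ^ j) / (1 + q ^ j)`. -/
noncomputable def ratio (j : ℕ) : (ZMod 3)⟦X⟧ := (1 - X ^ j) * (1 + X ^ j)⁻¹

lemma ratio_mul {j : ℕ} (hj : j ≠ 0) : ratio j * (1 + X ^ j) = 1 - X ^ j := by
  rw [ratio, mul_assoc, PowerSeries.inv_mul_cancel _ (by simp [hj]), mul_one]

/-- The series `1 / (1 - q ^ (m - j))`, where `m - j` may be negative. -/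
noncomputable def geomDiff (j m : ℕ) : (ZMod 3)⟦X⟧ :=
  if j < m then geomQ (m - j) else 1 - geomQ (j - m)

/-- The series `x m / (x j - x m)` for `x = lam`. -/
noncomputable def pairTerm (j m : ℕ) : (ZMod 3)⟦X⟧ := ratio j * (geomDiff j m - geomQ (m + j))

/-- The residue of `∏ m ∈ Icc 1 N, 1 / (1 - u * lam m)` at `u = 1 / lam j`. -/
noncomputable def res (N j : ℕ) : (ZMod 3)⟦X⟧ := ∏ m ∈ (Icc 1 N).erase j, (1 + pairTerm j m)

/-- The embedding of power series into their field of fractions. -/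
noncomputable abbrev toFrac : (ZMod 3)⟦X⟧ →+* FractionRing (ZMod 3)⟦X⟧ :=
  algebraMap (ZMod 3)⟦X⟧ (FractionRing (ZMod 3)⟦X⟧)

/-- The variable, in the field of fractions. -/
noncomputable abbrev qFrac : FractionRing (ZMod 3)⟦X⟧ := toFrac X

lemma toFrac_injective : Function.Injective toFrac := IsFractionRing.injective _ _

lemma qFrac_ne_zero : qFrac ≠ 0 := by
  rw [Ne, ← map_zero toFrac, toFrac_injective.eq_iff]
  exact X_ne_zero

lemma qFrac_pow_ne_one (m : ℕ) (hm : m ≠ 0) : qFrac ^ m ≠ 1 := by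
  rw [Ne, ← map_pow, ← map_one toFrac, toFrac_injective.eq_iff]
  intro h
  have := congrArg constantCoeff h
  simp [hm] at this

lemma qFrac_one_sub_ne_zero {m : ℕ} (hm : m ≠ 0) : 1 - qFrac ^ m ≠ 0 :=
  sub_ne_zero.2 (qFrac_pow_ne_one m hm).symm

lemma qFrac_one_add_ne_zero {m : ℕ} (hm : m ≠ 0) : 1 + qFrac ^ m ≠ 0 := by
  rw [Ne, ← map_pow, ← map_one toFrac, ← map_add, ← map_zero toFrac, toFrac_injective.eq_iff]
  intro h
  have := congrArg constantCoeff h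
  simp [hm] at this

lemma toFrac_geomQ {r : ℕ} (hr : r ≠ 0) : toFrac (geomQ r) = 1 / (1 - qFrac ^ r) := by
  rw [eq_div_iff (qFrac_one_sub_ne_zero hr), ← map_pow, ← map_one toFrac, ← map_sub, ← map_mul,
    geomQ_mul hr]

lemma toFrac_lam {m : ℕ} (hm : m ≠ 0) : toFrac (lam m) = lambert qFrac m := by
  rw [lam, map_mul, map_pow, map_pow, toFrac_geomQ hm, lambert, one_div, inv_pow, div_eq_mul_inv]

lemma toFrac_ratio {j : ℕ} (hj : j ≠ 0) :
    toFrac (ratio j) = (1 - qFrac ^ j) / (1 + qFrac ^ j) := by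
  rw [eq_div_iff (qFrac_one_add_ne_zero hj), ← map_pow, ← map_one toFrac, ← map_sub, ← map_add,
    ← map_mul, ratio_mul hj]

lemma toFrac_geomDiff {j m : ℕ} (h : j ≠ m) :
    toFrac (geomDiff j m) = 1 / (1 - (qFrac ^ j)⁻¹ * qFrac ^ m) := by
  have hj := pow_ne_zero j qFrac_ne_zero
  have hm := pow_ne_zero m qFrac_ne_zero
  rw [geomDiff]
  split_ifs with hlt
  · rw [toFrac_geomQ (by omega), pow_sub₀ _ qFrac_ne_zero hlt.le, mul_comm]
  · rw [map_sub, map_one, toFrac_geomQ (by omega)]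
    have h1 := sub_ne_zero.2 (pow_ne_pow_of_ne qFrac_ne_zero qFrac_pow_ne_one h)
    have h2 := sub_ne_zero.2 (pow_ne_pow_of_ne qFrac_ne_zero qFrac_pow_ne_one h.symm)
    rw [pow_sub₀ _ qFrac_ne_zero (by omega)]
    field_simp
    ring

/-- A partial fraction expansion in `q ^ m`. It shows that the quotient is a power series although
`lam j - lam m` is not invertible, which makes the residues power series as well. -/
lemma toFrac_pairTerm {j m : ℕ} (hj : j ≠ 0) (hm : m ≠ 0) (h : j ≠ m) :
    toFrac (pairTerm j m) = lambert qFrac m / (lambert qFrac j - lambert qFrac m) := by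
  have h1 := lambert_div_sub qFrac_ne_zero qFrac_pow_ne_one hj hm
  have h2 := lambert_sub_ne_zero qFrac_ne_zero qFrac_pow_ne_one hj hm h
  have h3 : lambert qFrac m / (lambert qFrac j - lambert qFrac m) =
      lambert qFrac j / (lambert qFrac j - lambert qFrac m) - 1 := by
    field_simp
    ring
  have e1 := sub_ne_zero.2 (pow_ne_pow_of_ne qFrac_ne_zero qFrac_pow_ne_one h)
  have e2 := one_sub_mul_ne_zero qFrac_pow_ne_one (j := j) (m := m) hj
  have e3 := qFrac_one_add_ne_zero hj
  have e4 := qFrac_one_sub_ne_zero hj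
  have e5 := pow_ne_zero j qFrac_ne_zero
  rw [h3, h1, pairTerm, map_mul, map_sub, toFrac_ratio hj, toFrac_geomDiff h,
    toFrac_geomQ (by omega), pow_add, mul_comm (qFrac ^ m) (qFrac ^ j)]
  field_simp
  ring

lemma toFrac_one_add_pairTerm {j m : ℕ} (hj : j ≠ 0) (hm : m ≠ 0) (h : j ≠ m) :
    toFrac (1 + pairTerm j m) = lambert qFrac j / (lambert qFrac j - lambert qFrac m) := by
  have h2 := lambert_sub_ne_zero qFrac_ne_zero qFrac_pow_ne_one hj hm h
  rw [map_add, map_one, toFrac_pairTerm hj hm h]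
  field_simp
  ring

lemma toFrac_res {N j : ℕ} (hj : j ≠ 0) :
    toFrac (res N j) = residue (lambert qFrac) (Icc 1 N) j := by
  rw [res, map_prod, residue]
  refine prod_congr rfl fun m hm => ?_
  simp only [mem_erase, mem_Icc] at hm
  exact toFrac_one_add_pairTerm hj (by omega) hm.1.symm

lemma pairTerm_mul {j m : ℕ} (hj : j ≠ 0) (hm : m ≠ 0) (h : j ≠ m) :
    pairTerm j m * (lam j - lam m) = lam m := by
  apply toFrac_injective
  rw [map_mul, map_sub, toFrac_lam hj, toFrac_lam hm, toFrac_pairTerm hj hm h,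
    div_mul_cancel₀ _ (lambert_sub_ne_zero qFrac_ne_zero qFrac_pow_ne_one hj hm h)]

lemma toFrac_hsymm {s : Finset ℕ} (hs : 0 ∉ s) (k : ℕ) :
    toFrac (hsymm lam s k) = hsymm (lambert qFrac) s k := by
  rw [map_hsymm, hsymm, hsymm, prod_congr rfl fun m hm => ?_]
  rw [toFrac_lam fun h => hs (h ▸ hm)]

lemma sum_res_mul_pow {N : ℕ} (hN : 1 ≤ N) (k : ℕ) :
    ∑ j ∈ Icc 1 N, res N j * lam j ^ k = hsymm lam (Icc 1 N) k := by
  apply toFrac_injective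
  rw [toFrac_hsymm (by simp), ← sum_residue_mul_pow _ (nonempty_Icc.2 hN)
    (lambert_injOn qFrac_ne_zero qFrac_pow_ne_one (by simp)), map_sum]
  refine sum_congr rfl fun j hj => ?_
  have hj0 : j ≠ 0 := by simp at hj; omega
  rw [map_mul, map_pow, toFrac_res hj0, toFrac_lam hj0]

lemma sum_res_reciprocity {N a : ℕ} (ha : a ∈ Icc 1 N) :
    ∑ m ∈ (Icc 1 N).erase a, res N m * pairTerm m a =
      ∑ m ∈ (Icc 1 N).erase a, res N a * pairTerm a m := by
  apply toFrac_injective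
  have h := sum_residue_reciprocity (lambert qFrac)
    (lambert_injOn qFrac_ne_zero qFrac_pow_ne_one (s := Icc 1 N) (by simp)) ha
  have ha0 : a ≠ 0 := by simp at ha; omega
  rw [map_sum, map_sum]
  convert! h using 1
  · refine sum_congr rfl fun m hm => ?_
    simp only [mem_erase, mem_Icc] at hm
    rw [map_mul, toFrac_res (by omega), toFrac_pairTerm (by omega) ha0 hm.1]
  · refine sum_congr rfl fun m hm => ?_
    simp only [mem_erase, mem_Icc] at hm
    rw [map_mul, toFrac_res (by omega), toFrac_pairTerm ha0 (by omega) hm.1.symm]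

lemma toFrac_qPoch (n : ℕ) : toFrac (qPoch X X n) = qPoch qFrac qFrac n := by
  simp [qPoch, map_prod]

lemma sum_qPoch_mul_lam_mul_hsymm (k N : ℕ) :
    ∑ n ∈ Icc 1 N, qPoch X X n * lam n * hsymm lam (Icc n N) k =
      ∑ j ∈ Icc 1 N, res N j * lam j ^ (k + 1) * (1 - X ^ j ^ 2) := by
  apply toFrac_injective
  have h := sum_qPoch_mul_hsymm qFrac_ne_zero qFrac_pow_ne_one k N
  rw [map_sum, map_sum]
  convert! h using 1
  · refine sum_congr rfl fun m hm => ?_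
    simp only [mem_Icc] at hm
    rw [map_mul, map_mul, toFrac_qPoch, toFrac_lam (by omega), toFrac_hsymm (by simp; omega)]
  · refine sum_congr rfl fun m hm => ?_
    simp only [mem_Icc] at hm
    rw [map_mul, map_mul, map_pow, map_sub, map_pow, map_one, toFrac_res (by omega),
      toFrac_lam (by omega)]

lemma res_sq {j : ℕ} (hj : j ≠ 0) (t : ℕ) :
    res (j + t) j ^ 2 * (qPoch X X t * qPoch X X (j + t + j)) ^ 2 =
      X ^ (j * (j - 1)) * (1 + X ^ j) ^ 2 * qPoch X X (j + t) ^ 4 := by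
  apply toFrac_injective
  have h := residue_lambert_sq qFrac_ne_zero qFrac_pow_ne_one hj t
  simpa only [map_mul, map_pow, map_add, map_one, toFrac_res hj, toFrac_qPoch] using h

lemma sum_pow_three {ι : Type*} (s : Finset ι) (f : ι → (ZMod 3)⟦X⟧) :
    (∑ i ∈ s, f i) ^ 3 = ∑ i ∈ s, f i ^ 3 :=
  sum_pow_char 3 s f

/-- Frobenius cubes `sum_res_reciprocity` termwise. The cubed weights then have equal row and column
sums at each index, so differences `f j - f m` cancel. -/
lemma sum_res_mul_pairTerm_cube (N : ℕ) (f : ℕ → (ZMod 3)⟦X⟧) :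
    ∑ j ∈ Icc 1 N, ∑ m ∈ (Icc 1 N).erase j, res N j ^ 3 * pairTerm j m ^ 3 * (f j - f m) = 0 := by
  simp only [mul_sub, sum_sub_distrib]
  rw [sub_eq_zero, eq_comm, sum_comm' (t' := Icc 1 N) (s' := fun m => (Icc 1 N).erase m)]
  swap
  · intro a b
    simp only [mem_erase]
    tauto
  · refine sum_congr rfl fun a ha => ?_
    have h := congrArg (· ^ 3) (sum_res_reciprocity ha)
    simp only [sum_pow_three, mul_pow] at h
    rw [← sum_mul, ← sum_mul, h]

/-- With `d = lam j - lam m` and `y = pairTerm j m` one has `lam m = y d` and `lam j = (1 + y) d`,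
which leaves a polynomial identity modulo 3. The term in `pairTerm j m ^ 3` has the shape killed by
`sum_res_mul_pairTerm_cube`. -/
lemma pairTerm_sq_identity {j m : ℕ} (hj : j ≠ 0) (hm : m ≠ 0) (h : j ≠ m) :
    lam j ^ 2 * pairTerm j m ^ 2 = lam m ^ 2 - pairTerm j m ^ 3 * (lam j ^ 2 - lam m ^ 2) := by
  have h1 := pairTerm_mul hj hm h
  obtain ⟨d, hd⟩ : ∃ d, d = lam j - lam m := ⟨_, rfl⟩
  rw [← hd] at h1
  have h2 : lam j = d + pairTerm j m * d := by rw [h1, hd]; ring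
  rw [h2, ← h1]
  generalize pairTerm j m = y
  linear_combination (y ^ 3 * d ^ 2 + y ^ 4 * d ^ 2) * three_eq_zero

lemma pairTerm_four_identity {j m : ℕ} (hj : j ≠ 0) (hm : m ≠ 0) (h : j ≠ m) :
    lam j ^ 4 * (pairTerm j m - pairTerm j m ^ 2) =
      lam m ^ 4 + lam j ^ 3 * lam m - pairTerm j m ^ 3 * (lam j ^ 4 - lam m ^ 4) := by
  have h1 := pairTerm_mul hj hm h
  obtain ⟨d, hd⟩ : ∃ d, d = lam j - lam m := ⟨_, rfl⟩
  rw [← hd] at h1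
  have h2 : lam j = d + pairTerm j m * d := by rw [h1, hd]; ring
  rw [h2, ← h1]
  generalize pairTerm j m = y
  linear_combination (y ^ 5 * d ^ 4 + y ^ 6 * d ^ 4) * three_eq_zero

/-- The power sum `∑ lam m ^ k`. -/
noncomputable def psumLam (N k : ℕ) : (ZMod 3)⟦X⟧ := ∑ m ∈ Icc 1 N, lam m ^ k

/-- The sum over `m ≠ j` of the powers `(lam m / (lam j - lam m)) ^ k`. -/
noncomputable def pairSum (N j k : ℕ) : (ZMod 3)⟦X⟧ := ∑ m ∈ (Icc 1 N).erase j, pairTerm j m ^ k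

lemma sum_res_cube {N : ℕ} (hN : 1 ≤ N) : ∑ j ∈ Icc 1 N, res N j ^ 3 = 1 := by
  have h := congrArg (· ^ 3) (sum_res_mul_pow hN 0)
  simpa [sum_pow_three, hsymm_zero] using h

lemma sum_res_cube_mul (N : ℕ) (hN : 1 ≤ N) :
    ∑ j ∈ Icc 1 N, res N j ^ 3 * lam j ^ 3 = psumLam N 1 ^ 3 := by
  have h := congrArg (· ^ 3) (sum_res_mul_pow hN 1)
  simpa [sum_pow_three, mul_pow, hsymm_one, psumLam] using h

/-- Sum `pairTerm_sq_identity` over `m ≠ j` and then over `j` with weights `res N j ^ 3`, whose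
total is `1`. -/
lemma two_mul_psumLam_two {N : ℕ} (hN : 1 ≤ N) :
    ∑ j ∈ Icc 1 N, res N j ^ 3 * lam j ^ 2 * (2 - pairSum N j 2) = 2 * psumLam N 2 := by
  have h0 := sum_res_mul_pairTerm_cube N fun j => lam j ^ 2
  have h1 : 2 * psumLam N 2 = ∑ j ∈ Icc 1 N, res N j ^ 3 * (2 * psumLam N 2) := by
    rw [← sum_mul, sum_res_cube hN, one_mul]
  rw [h1, ← sub_eq_zero, ← sum_sub_distrib, ← h0]
  refine sum_congr rfl fun j hj => ?_
  have h2 : psumLam N 2 = lam j ^ 2 + ∑ m ∈ (Icc 1 N).erase j, lam m ^ 2 :=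
    (add_sum_erase _ _ hj).symm
  have h3 : lam j ^ 2 * pairSum N j 2 = ∑ m ∈ (Icc 1 N).erase j, lam m ^ 2 -
      ∑ m ∈ (Icc 1 N).erase j, pairTerm j m ^ 3 * (lam j ^ 2 - lam m ^ 2) := by
    rw [pairSum, mul_sum, ← sum_sub_distrib]
    refine sum_congr rfl fun m hm => ?_
    simp only [mem_erase, mem_Icc] at hm hj
    exact pairTerm_sq_identity (by omega) (by omega) hm.1.symm
  simp only [mul_assoc, ← mul_sum]
  rw [h2]
  linear_combination (-res N j ^ 3) * h3 -
    res N j ^ 3 * (∑ m ∈ (Icc 1 N).erase j, lam m ^ 2) * three_eq_zero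

lemma psumLam_four {N : ℕ} (hN : 1 ≤ N) :
    ∑ j ∈ Icc 1 N, res N j ^ 3 * lam j ^ 4 * (2 + pairSum N j 1 - pairSum N j 2) =
      psumLam N 4 + psumLam N 1 ^ 4 := by
  have h0 := sum_res_mul_pairTerm_cube N fun j => lam j ^ 4
  have h1 : psumLam N 4 + psumLam N 1 ^ 4 =
      ∑ j ∈ Icc 1 N, res N j ^ 3 * (psumLam N 4 + lam j ^ 3 * psumLam N 1) := by
    simp only [mul_add, sum_add_distrib]
    rw [← sum_mul, sum_res_cube hN, one_mul]
    simp only [← mul_assoc]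
    rw [← sum_mul, sum_res_cube_mul N hN]
    ring
  rw [h1, ← sub_eq_zero, ← sum_sub_distrib, ← neg_eq_zero, ← h0, ← sum_neg_distrib]
  refine sum_congr rfl fun j hj => ?_
  have h2 : psumLam N 4 = lam j ^ 4 + ∑ m ∈ (Icc 1 N).erase j, lam m ^ 4 :=
    (add_sum_erase _ _ hj).symm
  have h2' : psumLam N 1 = lam j + ∑ m ∈ (Icc 1 N).erase j, lam m := by
    simp only [psumLam, pow_one]
    exact (add_sum_erase _ _ hj).symm
  have h3 : lam j ^ 4 * (pairSum N j 1 - pairSum N j 2) =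
      ∑ m ∈ (Icc 1 N).erase j, lam m ^ 4 + lam j ^ 3 * ∑ m ∈ (Icc 1 N).erase j, lam m -
      ∑ m ∈ (Icc 1 N).erase j, pairTerm j m ^ 3 * (lam j ^ 4 - lam m ^ 4) := by
    rw [pairSum, pairSum, ← sum_sub_distrib, mul_sum, mul_sum, ← sum_add_distrib,
      ← sum_sub_distrib]
    refine sum_congr rfl fun m hm => ?_
    simp only [mem_erase, mem_Icc] at hm hj
    rw [pow_one, pairTerm_four_identity (by omega) (by omega) hm.1.symm]
  simp only [mul_assoc, ← mul_sum]
  rw [h2, h2']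
  linear_combination (-res N j ^ 3) * h3

end HigherSpt

/-! ### The Euler operator, truncation, and the sums over pairs of poles. -/

namespace HigherSpt

open Finset PowerSeries

/-- The Euler operator `q d/dq`. -/
noncomputable def eulerD : Derivation (ZMod 3) (ZMod 3)⟦X⟧ (ZMod 3)⟦X⟧ :=
  (X : (ZMod 3)⟦X⟧) • derivative (ZMod 3)

lemma eulerD_apply (f : (ZMod 3)⟦X⟧) : eulerD f = X * derivative (ZMod 3) f := rfl

lemma coeff_eulerD (f : (ZMod 3)⟦X⟧) (n : ℕ) : coeff n (eulerD f) = n * coeff n f := by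
  rw [eulerD_apply]
  rcases n with - | n
  · simp
  · rw [coeff_succ_X_mul, coeff_derivative]
    push_cast
    ring

lemma eulerD_mul (f g : (ZMod 3)⟦X⟧) : eulerD (f * g) = f * eulerD g + g * eulerD f := by
  rw [Derivation.leibniz, smul_eq_mul, smul_eq_mul]

lemma eulerD_cube (f : (ZMod 3)⟦X⟧) : eulerD (f ^ 3) = 0 := by
  rw [Derivation.leibniz_pow, nsmul_eq_mul]
  have := three_eq_zero
  push_cast
  rw [this, zero_mul]

lemma eulerD_cube_mul (f g : (ZMod 3)⟦X⟧) : eulerD (f ^ 3 * g) = f ^ 3 * eulerD g := by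
  rw [eulerD_mul, eulerD_cube, mul_zero, add_zero]

lemma eulerD_X_pow (j : ℕ) : eulerD (X ^ j) = (j : (ZMod 3)⟦X⟧) * X ^ j := by
  ext n
  rw [coeff_eulerD, ← map_natCast (C (R := ZMod 3)), coeff_C_mul, coeff_X_pow]
  split_ifs with h
  · rw [h]
  · simp

/-- Fermat's little theorem `n ^ 3 = n`, coefficient by coefficient. -/
lemma eulerD_eulerD_eulerD (f : (ZMod 3)⟦X⟧) : eulerD (eulerD (eulerD f)) = eulerD f := by
  ext n
  simp only [coeff_eulerD]
  have h : ∀ a : ZMod 3, a * (a * a) = a := by decide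
  rw [← mul_assoc, ← mul_assoc, mul_assoc (n : ZMod 3), h]

/-- Reduction of power series modulo `q ^ M`. -/
noncomputable abbrev modX (M : ℕ) : (ZMod 3)⟦X⟧ →+* (ZMod 3)⟦X⟧ ⧸ Ideal.span {(X : (ZMod 3)⟦X⟧) ^ M} :=
  Ideal.Quotient.mk _

lemma modX_eq_iff {M : ℕ} {a b : (ZMod 3)⟦X⟧} : modX M a = modX M b ↔ X ^ M ∣ a - b := by
  rw [Ideal.Quotient.eq, Ideal.mem_span_singleton]

lemma coeff_eq_of_modX_eq {M n : ℕ} {a b : (ZMod 3)⟦X⟧} (h : modX M a = modX M b) (hn : n < M) :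
    coeff n a = coeff n b := by
  rw [modX_eq_iff, X_pow_dvd_iff] at h
  have := h n hn
  rwa [map_sub, sub_eq_zero] at this

lemma modX_eulerD {M : ℕ} {a b : (ZMod 3)⟦X⟧} (h : modX M a = modX M b) :
    modX M (eulerD a) = modX M (eulerD b) := by
  rw [modX_eq_iff, X_pow_dvd_iff] at h ⊢
  intro n hn
  rw [← map_sub, coeff_eulerD, h n hn, mul_zero]

/-- A factor divisible by `X ^ i` gains `i` orders of precision. This makes up for congruences about
the pole `j` that hold only modulo `X ^ (N - j + 1)`. -/
lemma modX_mul_left {M M' i : ℕ} {a b c : (ZMod 3)⟦X⟧} (hc : X ^ i ∣ c)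
    (h : modX M a = modX M b) (hM : M' ≤ i + M) : modX M' (c * a) = modX M' (c * b) := by
  rw [modX_eq_iff] at h ⊢
  rw [← mul_sub]
  exact (pow_dvd_pow X hM).trans (by rw [pow_add]; exact mul_dvd_mul hc h)

lemma modX_geomQ {M r : ℕ} (hr : M ≤ r) (h0 : r ≠ 0) : modX M (geomQ r) = 1 := by
  rw [← map_one (modX M), modX_eq_iff]
  have h : geomQ r - 1 = X ^ r * geomQ r := by linear_combination geomQ_mul h0
  rw [h]
  exact (pow_dvd_pow X hr).mul_right _

lemma modX_lam {M r : ℕ} (hr : M ≤ r) : modX M (lam r) = 0 := by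
  rw [← map_zero (modX M), modX_eq_iff, sub_zero, lam]
  exact (pow_dvd_pow X hr).mul_right _

lemma sum_erase_split {S : Type*} [AddCommGroup S] (f : ℕ → S) (j t : ℕ) :
    ∑ m ∈ (Icc 1 (j + t)).erase j, f m = ∑ m ∈ Ico 1 j, f m + ∑ m ∈ Icc 1 t, f (m + j) := by
  have h1 : (Icc 1 (j + t)).erase j = Ico 1 j ∪ (Icc 1 t).map (addRightEmbedding j) := by
    ext a
    simp only [mem_erase, mem_Icc, mem_union, mem_Ico, mem_map, addRightEmbedding_apply]
    constructor
    · intro h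
      by_cases ha : a < j
      · exact Or.inl (by omega)
      · exact Or.inr ⟨a - j, by omega, by omega⟩
    · rintro (h | ⟨b, h, rfl⟩) <;> omega
  rw [h1, sum_union, sum_map]
  · rfl
  · rw [disjoint_left]
    intro a ha hb
    simp only [mem_Ico, mem_map, mem_Icc, addRightEmbedding_apply] at ha hb
    obtain ⟨b, hb, rfl⟩ := hb
    omega

lemma sum_erase_shift {S : Type*} [AddCommGroup S] (f : ℕ → S) {j : ℕ} (hj : j ≠ 0) (t : ℕ) :
    ∑ m ∈ (Icc 1 (j + t)).erase j, f (m + j) =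
      ∑ r ∈ Icc 1 (t + (j + j)), f r - ∑ r ∈ Icc 1 j, f r - f (j + j) := by
  have h1 : ∑ m ∈ (Icc 1 (j + t)).erase j, f (m + j) + f (j + j) =
      ∑ m ∈ Icc 1 (j + t), f (m + j) :=
    Finset.sum_erase_add _ (fun m => f (m + j)) (by rw [mem_Icc]; omega)
  have h2 : ∑ r ∈ Icc 1 (t + (j + j)), f r = ∑ r ∈ Icc 1 j, f r + ∑ m ∈ Icc 1 (j + t), f (m + j) := by
    have h3 : Icc 1 (t + (j + j)) = Icc 1 j ∪ (Icc 1 (j + t)).map (addRightEmbedding j) := by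
      ext a
      simp only [mem_Icc, mem_union, mem_map, addRightEmbedding_apply]
      constructor
      · intro h
        by_cases ha : a ≤ j
        · exact Or.inl (by omega)
        · exact Or.inr ⟨a - j, by omega, by omega⟩
      · rintro (h | ⟨b, h, rfl⟩) <;> omega
    rw [h3, sum_union, sum_map]
    · rfl
    · rw [disjoint_left]
      intro a ha hb
      simp only [mem_map, mem_Icc, addRightEmbedding_apply] at ha hb
      obtain ⟨b, hb, rfl⟩ := hb
      omega
  rw [h2, ← h1]
  abel

lemma sum_erase_diff {S : Type*} [AddCommGroup S] (f g : ℕ → S) {j : ℕ} (hj : j ≠ 0) (t : ℕ) :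
    ∑ m ∈ (Icc 1 (j + t)).erase j, (if j < m then f (m - j) else g (j - m)) =
      ∑ r ∈ Icc 1 t, f r + ∑ r ∈ Icc 1 j, g r - g j := by
  rw [sum_erase_split]
  have h1 : ∑ m ∈ Icc 1 t, (if j < m + j then f (m + j - j) else g (j - (m + j))) =
      ∑ m ∈ Icc 1 t, f m := by
    refine sum_congr rfl fun m hm => ?_
    rw [mem_Icc] at hm
    rw [if_pos (by omega), Nat.add_sub_cancel]
  have h2 : ∑ m ∈ Ico 1 j, (if j < m then f (m - j) else g (j - m)) = ∑ m ∈ Ico 1 j, g m := by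
    refine sum_nbij' (fun m => j - m) (fun m => j - m) ?_ ?_ ?_ ?_ ?_ <;>
      intro m hm <;> rw [mem_Ico] at hm
    · simp only [mem_Ico]; omega
    · simp only [mem_Ico]; omega
    · omega
    · omega
    · rw [if_neg (by omega)]
  have h3 : ∑ m ∈ Icc 1 j, g m = ∑ m ∈ Ico 1 j, g m + g j := by
    obtain ⟨i, rfl⟩ := Nat.exists_eq_succ_of_ne_zero hj
    rw [Nat.succ_eq_add_one, sum_Icc_succ_top (by omega)]
    rfl
  rw [h1, h2, h3]
  abel

lemma modX_sum_tail {M : ℕ} (f : ℕ → (ZMod 3)⟦X⟧) (c : (ZMod 3)⟦X⟧) {t : ℕ}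
    (h : ∀ r, t < r → modX M (f r) = modX M c) (d : ℕ) :
    modX M (∑ r ∈ Icc 1 (t + d), f r) = modX M (∑ r ∈ Icc 1 t, f r + d * c) := by
  induction d with
  | zero => simp
  | succ d ih =>
    rw [← add_assoc, sum_Icc_succ_top (by omega), map_add, ih, h _ (by omega), ← map_add]
    congr 1
    push_cast
    ring

/-- The sum over `m ≠ j` of `1 / (1 - q ^ (m - j)) - 1 / (1 - q ^ (m + j))`. -/
noncomputable def diffSum (N j : ℕ) : (ZMod 3)⟦X⟧ :=
  ∑ m ∈ (Icc 1 N).erase j, (geomDiff j m - geomQ (m + j))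

lemma three_eq_zero_frac : (3 : FractionRing (ZMod 3)⟦X⟧) = 0 := by
  rw [← map_ofNat toFrac 3, three_eq_zero, map_zero]

lemma geomQ_add_geomQ {j : ℕ} (hj : j ≠ 0) : geomQ j + geomQ (j + j) - 1 = ratio j := by
  apply toFrac_injective
  have h1 := qFrac_one_sub_ne_zero hj
  have h2 := qFrac_one_add_ne_zero hj
  have h3 : toFrac (geomQ (j + j)) = 1 / ((1 - qFrac ^ j) * (1 + qFrac ^ j)) := by
    rw [toFrac_geomQ (by omega), pow_add]
    ring_nf
  rw [map_sub, map_add, map_one, toFrac_geomQ hj, toFrac_ratio hj, h3]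
  field_simp
  linear_combination qFrac ^ j * three_eq_zero_frac

/-- The two sums of `geomQ` differ by a tail of `2 j` terms, each congruent to `1`; the omitted
terms and the reflected ones with `m < j` account for the rest. -/
lemma modX_diffSum {j : ℕ} (hj : j ≠ 0) (t : ℕ) :
    modX (t + 1) (diffSum (j + t) j) = modX (t + 1) (ratio j - j) := by
  have h1 : diffSum (j + t) j = ∑ r ∈ Icc 1 t, geomQ r - ∑ r ∈ Icc 1 (t + (j + j)), geomQ r +
      (j - 1 + geomQ j + geomQ (j + j)) := by
    rw [diffSum, sum_sub_distrib, sum_erase_shift _ hj]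
    simp only [geomDiff]
    rw [sum_erase_diff geomQ (fun r => 1 - geomQ r) hj]
    simp only [sum_sub_distrib, sum_const, Nat.card_Icc, Nat.add_sub_cancel, nsmul_eq_mul, mul_one]
    ring
  have h2 := modX_sum_tail (M := t + 1) geomQ 1 (t := t)
    (fun r hr => (modX_geomQ hr (by omega)).trans (map_one _).symm) (j + j)
  rw [h1, ← geomQ_add_geomQ hj, map_add, map_sub, h2]
  simp only [← map_add, ← map_sub]
  congr 1
  push_cast
  linear_combination (0 : (ZMod 3)⟦X⟧) * three_eq_zero

/-- For `g = 1 / (1 - a)` one has `g ^ 2 = g + a / (1 - a) ^ 2`, and the cross term splits by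
partial fractions in `q ^ m`. -/
lemma geomDiff_sub_sq {j m : ℕ} (hj : j ≠ 0) (h : j ≠ m) :
    (geomDiff j m - geomQ (m + j)) ^ 2 =
      (if j < m then lam (m - j) else lam (j - m)) + lam (m + j) +
        (geomDiff j m - geomQ (m + j)) * (1 - 2 * geomQ (j + j)) := by
  have e0 := pow_ne_zero j qFrac_ne_zero
  have e0' := pow_ne_zero m qFrac_ne_zero
  have e1 := sub_ne_zero.2 (pow_ne_pow_of_ne qFrac_ne_zero qFrac_pow_ne_one h)
  have e1' := sub_ne_zero.2 (pow_ne_pow_of_ne qFrac_ne_zero qFrac_pow_ne_one h.symm)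
  have e2 := one_sub_mul_ne_zero qFrac_pow_ne_one (j := j) (m := m) hj
  have e3 := one_sub_mul_ne_zero qFrac_pow_ne_one (j := j) (m := j) hj
  have hl : toFrac (if j < m then lam (m - j) else lam (j - m)) =
      qFrac ^ j * qFrac ^ m / (qFrac ^ j - qFrac ^ m) ^ 2 := by
    split_ifs with hlt
    · rw [toFrac_lam (by omega), lambert, pow_sub₀ _ qFrac_ne_zero hlt.le]
      field_simp
    · rw [toFrac_lam (by omega), lambert, pow_sub₀ _ qFrac_ne_zero (by omega)]
      rw [← neg_sq (qFrac ^ j - qFrac ^ m), neg_sub]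
      field_simp
  apply toFrac_injective
  simp only [map_add, map_mul, map_sub, map_pow, map_one, map_ofNat, hl]
  rw [toFrac_geomDiff h, toFrac_geomQ (by omega), toFrac_geomQ (by omega), toFrac_lam (by omega),
    lambert, pow_add, pow_add, mul_comm (qFrac ^ m)]
  generalize qFrac ^ j = a at *
  generalize qFrac ^ m = b at *
  rw [← sq] at e3 ⊢
  field_simp
  ring

lemma pairSum_one (N j : ℕ) : pairSum N j 1 = ratio j * diffSum N j := by
  simp only [pairSum, pow_one, pairTerm, diffSum, mul_sum]

lemma modX_pairSum_two {j : ℕ} (hj : j ≠ 0) (t : ℕ) :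
    modX (t + 1) (pairSum (j + t) j 2) = modX (t + 1) (ratio j ^ 2 *
      (2 * psumLam (j + t) 1 - lam j - lam (j + j) +
        (ratio j - j) * (1 - 2 * geomQ (j + j)))) := by
  have h1 : pairSum (j + t) j 2 = ratio j ^ 2 * (∑ r ∈ Icc 1 t, lam r +
      ∑ r ∈ Icc 1 (t + (j + j)), lam r - lam j - lam (j + j) +
        diffSum (j + t) j * (1 - 2 * geomQ (j + j))) := by
    simp only [pairSum, pairTerm, mul_pow, ← mul_sum]
    congr 1
    rw [sum_congr rfl fun m hm => geomDiff_sub_sq hj (mem_erase.1 hm).1.symm, sum_add_distrib,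
      sum_add_distrib, ← sum_mul, ← diffSum, sum_erase_shift _ hj, sum_erase_diff _ _ hj]
    ring
  have h2 : ∀ d, modX (t + 1) (∑ r ∈ Icc 1 (t + d), lam r) = modX (t + 1) (∑ r ∈ Icc 1 t, lam r) := by
    intro d
    have := modX_sum_tail (M := t + 1) lam 0 (t := t)
      (fun r hr => (modX_lam hr).trans (map_zero _).symm) d
    simpa using this
  have h3 := h2 (j + j)
  have h4 := h2 j
  have h5 := modX_diffSum hj t
  rw [add_comm t j] at h4
  rw [h1]
  simp only [psumLam, pow_one]
  simp only [map_mul, map_add, map_sub, map_pow, map_one, map_ofNat] at h3 h4 h5 ⊢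
  rw [h3, h4, h5]
  ring

end HigherSpt

/-! ### Differential relations for the sums with cubed residues. -/

namespace HigherSpt

open Finset PowerSeries

lemma toFrac_geomQ_add {j : ℕ} (hj : j ≠ 0) :
    toFrac (geomQ (j + j)) = 1 / ((1 - qFrac ^ j) * (1 + qFrac ^ j)) := by
  rw [toFrac_geomQ (by omega), pow_add]
  ring_nf

lemma toFrac_lam_add {j : ℕ} (hj : j ≠ 0) :
    toFrac (lam (j + j)) = (qFrac ^ j) ^ 2 / ((1 - qFrac ^ j) * (1 + qFrac ^ j)) ^ 2 := by
  rw [toFrac_lam (by omega), lambert, pow_add]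
  ring_nf

/-- In any characteristic `1 + 4 q^j / (1 - q^j)^2 = ((1 + q^j) / (1 - q^j))^2`, and `4 = 1` modulo
3. -/
lemma one_add_lam_mul {j : ℕ} (hj : j ≠ 0) : (1 + lam j) * ratio j ^ 2 = 1 := by
  apply toFrac_injective
  have h1 := qFrac_one_sub_ne_zero hj
  have h2 := qFrac_one_add_ne_zero hj
  simp only [map_add, map_mul, map_pow, map_one, toFrac_lam hj, toFrac_ratio hj, lambert]
  generalize qFrac ^ j = a at *
  field_simp
  linear_combination (-a) * three_eq_zero_frac

lemma ratio_identity_linear {j : ℕ} (hj : j ≠ 0) :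
    -ratio j + ratio j ^ 2 * (1 - 2 * geomQ (j + j)) = ratio j ^ 3 := by
  apply toFrac_injective
  have h1 := qFrac_one_sub_ne_zero hj
  have h2 := qFrac_one_add_ne_zero hj
  simp only [map_add, map_neg, map_mul, map_sub, map_pow, map_one, map_ofNat, toFrac_ratio hj,
    toFrac_geomQ_add hj]
  generalize qFrac ^ j = a at *
  field_simp
  linear_combination (-1 - a ^ 2) * three_eq_zero_frac

lemma ratio_identity_const {j : ℕ} (hj : j ≠ 0) :
    1 + ratio j ^ 2 + ratio j ^ 2 * (lam j + lam (j + j)) -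
      ratio j ^ 3 * (1 - 2 * geomQ (j + j)) = 0 := by
  apply toFrac_injective
  have h1 := qFrac_one_sub_ne_zero hj
  have h2 := qFrac_one_add_ne_zero hj
  simp only [map_add, map_mul, map_sub, map_pow, map_one, map_zero, map_ofNat, toFrac_ratio hj,
    toFrac_geomQ_add hj, toFrac_lam_add hj, toFrac_lam hj, lambert]
  generalize qFrac ^ j = a at *
  field_simp
  linear_combination (1 + a + 3 * a ^ 2 + a ^ 3 + a ^ 4) * three_eq_zero_frac

lemma eulerD_geomQ {j : ℕ} (hj : j ≠ 0) : eulerD (geomQ j) = j * lam j := by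
  have h := congrArg eulerD (geomQ_mul hj)
  rw [eulerD_mul, map_sub, eulerD_X_pow, Derivation.map_one_eq_zero] at h
  rw [lam]
  linear_combination geomQ j * h - eulerD (geomQ j) * geomQ_mul hj

lemma eulerD_inv_one_add {j : ℕ} (hj : j ≠ 0) :
    eulerD (1 + X ^ j)⁻¹ = -((j : (ZMod 3)⟦X⟧) * X ^ j * ((1 + X ^ j)⁻¹ : (ZMod 3)⟦X⟧) ^ 2) := by
  have h0 : ((1 + X ^ j)⁻¹ : (ZMod 3)⟦X⟧) * (1 + X ^ j) = 1 :=
    PowerSeries.inv_mul_cancel _ (by simp [hj])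
  have h := congrArg eulerD h0
  rw [eulerD_mul, map_add, eulerD_X_pow, Derivation.map_one_eq_zero] at h
  linear_combination ((1 + X ^ j)⁻¹ : (ZMod 3)⟦X⟧) * h - eulerD (1 + X ^ j)⁻¹ * h0

lemma eulerD_lam_mul_ratio_sq {j : ℕ} (hj : j ≠ 0) :
    eulerD (lam j * ratio j ^ 2) = lam j * (j * ratio j ^ 3) := by
  have h0 : ((1 + X ^ j)⁻¹ : (ZMod 3)⟦X⟧) * (1 + X ^ j) = 1 :=
    PowerSeries.inv_mul_cancel _ (by simp [hj])
  have h1 := eulerD_inv_one_add hj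
  have h2 : lam j * ratio j ^ 2 = X ^ j * ((1 + X ^ j)⁻¹ : (ZMod 3)⟦X⟧) ^ 2 := by
    rw [lam, ratio]
    linear_combination X ^ j * ((1 + X ^ j)⁻¹ : (ZMod 3)⟦X⟧) ^ 2 *
      (geomQ j * (1 - X ^ j) + 1) * geomQ_mul hj
  have h3 : lam j * (j * ratio j ^ 3) = j * (lam j * ratio j ^ 2) * ratio j := by ring
  rw [h3, h2, eulerD_mul, eulerD_X_pow, Derivation.leibniz_pow, h1, ratio]
  simp only [smul_eq_mul, nsmul_eq_mul]
  generalize ((1 + X ^ j)⁻¹ : (ZMod 3)⟦X⟧) = v at *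
  push_cast
  linear_combination (-((j : (ZMod 3)⟦X⟧) * X ^ j * v ^ 2)) * h0

lemma eulerD_lam_sq_mul_ratio_sq {j : ℕ} (hj : j ≠ 0) :
    eulerD (lam j ^ 2 * ratio j ^ 2) = lam j ^ 2 * (j * (ratio j + ratio j ^ 3)) := by
  have h0 : ((1 + X ^ j)⁻¹ : (ZMod 3)⟦X⟧) * (1 + X ^ j) = 1 :=
    PowerSeries.inv_mul_cancel _ (by simp [hj])
  have h1 := eulerD_inv_one_add hj
  have e := eulerD_geomQ hj
  have g0 := geomQ_mul hj
  have h2 : lam j ^ 2 * ratio j ^ 2 = (X ^ j * geomQ j * ((1 + X ^ j)⁻¹ : (ZMod 3)⟦X⟧)) ^ 2 := by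
    rw [lam, ratio]
    linear_combination (X ^ j) ^ 2 * geomQ j ^ 2 * ((1 + X ^ j)⁻¹ : (ZMod 3)⟦X⟧) ^ 2 *
      (geomQ j * (1 - X ^ j) + 1) * g0
  rw [h2, Derivation.leibniz_pow, eulerD_mul, eulerD_mul, eulerD_X_pow, h1, e, lam, ratio]
  simp only [smul_eq_mul, nsmul_eq_mul]
  have e1 := qFrac_one_sub_ne_zero hj
  have e2 := qFrac_one_add_ne_zero hj
  have hv : toFrac (1 + X ^ j)⁻¹ = 1 / (1 + qFrac ^ j) := by
    rw [eq_div_iff e2, ← map_pow, ← map_one toFrac, ← map_add, ← map_mul, h0]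
  apply toFrac_injective
  simp only [map_add, map_mul, map_sub, map_neg, map_pow, map_one, map_natCast, hv,
    toFrac_geomQ hj]
  generalize qFrac ^ j = a at *
  push_cast
  field_simp
  ring

/-- The Lambert-type series `∑ j, c j ^ 3 x j ^ (k + 1) / (1 + x j)` for `x = lam`, `c = res N`. -/
noncomputable def cubicSum (N k : ℕ) : (ZMod 3)⟦X⟧ :=
  ∑ j ∈ Icc 1 N, res N j ^ 3 * (lam j ^ (k + 1) * ratio j ^ 2)

lemma X_pow_dvd_lam_pow (j k : ℕ) : X ^ (j * k) ∣ lam j ^ k := by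
  rw [lam, mul_pow, ← pow_mul]
  exact Dvd.intro _ rfl

/-- By `eulerD_lam_mul_ratio_sq`, the term `j * ratio j ^ 3` times `lam j` is a derivative. This is
how sums over pairs of poles become `eulerD` of a `cubicSum`. -/
lemma modX_pairSum_identity_four {N j : ℕ} (hj : j ≠ 0) (hjN : j ≤ N) :
    modX (N - j + 1) (1 + pairSum N j 1 - pairSum N j 2) =
      modX (N - j + 1) (j * ratio j ^ 3 + psumLam N 1 * ratio j ^ 2) := by
  obtain ⟨t, rfl⟩ := Nat.exists_eq_add_of_le hjN
  rw [Nat.add_sub_cancel_left, pairSum_one, map_sub, map_add, modX_pairSum_two hj, map_mul,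
    modX_diffSum hj, ← map_mul, ← map_add, ← map_sub]
  congr 1
  linear_combination ratio_identity_const hj + (j : (ZMod 3)⟦X⟧) * ratio_identity_linear hj -
    psumLam (j + t) 1 * ratio j ^ 2 * three_eq_zero

/-- Multiplied by `lam j ^ 2`, the three terms on the right give the contributions of `j` to
`cubicSum N 2`, to `eulerD (cubicSum N 1)` by `eulerD_lam_sq_mul_ratio_sq`, and to `psumLam N 1 *
cubicSum N 1`. -/
lemma modX_pairSum_identity_two {N j : ℕ} (hj : j ≠ 0) (hjN : j ≤ N) :
    modX (N - j + 1) (2 - pairSum N j 2) =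
      modX (N - j + 1) (lam j * ratio j ^ 2 + j * (ratio j + ratio j ^ 3) +
        psumLam N 1 * ratio j ^ 2) := by
  obtain ⟨t, rfl⟩ := Nat.exists_eq_add_of_le hjN
  rw [Nat.add_sub_cancel_left, map_sub, modX_pairSum_two hj, ← map_sub]
  congr 1
  linear_combination ratio_identity_const hj + (j : (ZMod 3)⟦X⟧) * ratio_identity_linear hj -
    psumLam (j + t) 1 * ratio j ^ 2 * three_eq_zero - one_add_lam_mul hj

lemma cubicSum_add (N k : ℕ) :
    cubicSum N (k + 1) + cubicSum N k = ∑ j ∈ Icc 1 N, res N j ^ 3 * lam j ^ (k + 1) := by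
  rw [cubicSum, cubicSum, ← sum_add_distrib]
  refine sum_congr rfl fun j hj => ?_
  rw [mem_Icc] at hj
  linear_combination res N j ^ 3 * lam j ^ (k + 1) * one_add_lam_mul (j := j) (by omega)

lemma modX_cubicSum_four {N : ℕ} (hN : 1 ≤ N) :
    modX (N + 1) (cubicSum N 4 + cubicSum N 3 + (eulerD (cubicSum N 3) +
      psumLam N 1 * cubicSum N 3)) = modX (N + 1) (psumLam N 4 + psumLam N 1 ^ 4) := by
  rw [← psumLam_four hN, cubicSum_add, cubicSum, map_sum eulerD, mul_sum, ← sum_add_distrib,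
    ← sum_add_distrib, map_sum, map_sum]
  refine sum_congr rfl fun j hj => ?_
  rw [mem_Icc] at hj
  have h := modX_mul_left (c := res N j ^ 3 * lam j ^ 4) (i := j * 4) (M' := N + 1)
    ((X_pow_dvd_lam_pow j 4).mul_left _) (modX_pairSum_identity_four (by omega) hj.2) (by omega)
  have h2 : eulerD (res N j ^ 3 * (lam j ^ (3 + 1) * ratio j ^ 2)) =
      res N j ^ 3 * lam j ^ 4 * (j * ratio j ^ 3) := by
    rw [eulerD_cube_mul, pow_succ (lam j) 3, mul_assoc (lam j ^ 3), eulerD_cube_mul,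
      eulerD_lam_mul_ratio_sq (by omega)]
    ring
  have h3 : res N j ^ 3 * lam j ^ (3 + 1) + (eulerD (res N j ^ 3 * (lam j ^ (3 + 1) * ratio j ^ 2)) +
      psumLam N 1 * (res N j ^ 3 * (lam j ^ (3 + 1) * ratio j ^ 2))) =
      res N j ^ 3 * lam j ^ 4 + res N j ^ 3 * lam j ^ 4 *
        (j * ratio j ^ 3 + psumLam N 1 * ratio j ^ 2) := by
    rw [h2]
    ring
  rw [h3, map_add, ← h, ← map_add]
  congr 1
  ring

lemma modX_cubicSum_two {N : ℕ} (hN : 1 ≤ N) :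
    modX (N + 1) (cubicSum N 2 + (eulerD (cubicSum N 1) + psumLam N 1 * cubicSum N 1)) =
      modX (N + 1) (2 * psumLam N 2) := by
  rw [← two_mul_psumLam_two hN, cubicSum, cubicSum, map_sum eulerD, mul_sum, ← sum_add_distrib,
    ← sum_add_distrib, map_sum, map_sum]
  refine sum_congr rfl fun j hj => ?_
  rw [mem_Icc] at hj
  have h := modX_mul_left (c := res N j ^ 3 * lam j ^ 2) (i := j * 2) (M' := N + 1)
    ((X_pow_dvd_lam_pow j 2).mul_left _) (modX_pairSum_identity_two (by omega) hj.2) (by omega)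
  rw [h, eulerD_cube_mul, eulerD_lam_sq_mul_ratio_sq (by omega)]
  congr 1
  ring

lemma cubicSum_three_add_two {N : ℕ} (hN : 1 ≤ N) :
    cubicSum N 3 + cubicSum N 2 = psumLam N 1 ^ 3 := by
  rw [cubicSum_add, sum_res_cube_mul N hN]

lemma modX_qPoch {M t d : ℕ} (hM : M ≤ t + 1) :
    modX M (qPoch X X (t + d)) = modX M (qPoch X X t) := by
  induction d with
  | zero => rfl
  | succ d ih =>
    have h : modX M (X * X ^ (t + d)) = 0 := by
      rw [← map_zero (modX M), modX_eq_iff, sub_zero, ← pow_succ']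
      exact pow_dvd_pow X (by omega)
    rw [← add_assoc, qPoch_succ, map_mul, map_sub, h, ih]
    simp

lemma isUnit_qPoch (n : ℕ) : IsUnit (qPoch (X : (ZMod 3)⟦X⟧) X n) := by
  rw [PowerSeries.isUnit_iff_constantCoeff]
  simp [qPoch, map_prod]

/-- To this precision all shifted factorials in `res_sq` agree with the unit `qPoch X X t`, and they
cancel. -/
lemma modX_res_sq {N j : ℕ} (hj : j ≠ 0) (hjN : j ≤ N) :
    modX (N - j + 1) (res N j ^ 2 * (lam j * ratio j ^ 2)) = modX (N - j + 1) (X ^ j ^ 2) := by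
  obtain ⟨t, rfl⟩ := Nat.exists_eq_add_of_le hjN
  rw [Nat.add_sub_cancel_left]
  have h := congrArg (modX (t + 1)) (res_sq hj t)
  have h1 : modX (t + 1) (qPoch X X (j + t)) = modX (t + 1) (qPoch X X t) := by
    rw [add_comm j t]
    exact modX_qPoch le_rfl
  have h2 : modX (t + 1) (qPoch X X (j + t + j)) = modX (t + 1) (qPoch X X t) := by
    rw [add_comm j t, add_assoc]
    exact modX_qPoch le_rfl
  simp only [map_mul, map_pow, map_add, map_one, h1, h2] at h
  have hu : IsUnit (modX (t + 1) (qPoch X X t) ^ 4) := ((isUnit_qPoch t).map _).pow 4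
  have h3 : modX (t + 1) (res (j + t) j ^ 2) =
      modX (t + 1) (X ^ (j * (j - 1)) * (1 + X ^ j) ^ 2) := by
    apply hu.mul_right_cancel
    simp only [map_mul, map_pow, map_add, map_one]
    rw [← h]
    ring
  rw [map_mul, h3, ← map_mul]
  congr 1
  have h4 : lam j * ratio j ^ 2 * (1 + X ^ j) ^ 2 = X ^ j := by
    rw [mul_assoc, ← mul_pow, ratio_mul hj, lam]
    linear_combination X ^ j * (geomQ j * (1 - X ^ j) + 1) * geomQ_mul hj
  have h5 : j ^ 2 = j * (j - 1) + j := by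
    obtain ⟨i, rfl⟩ := Nat.exists_eq_succ_of_ne_zero hj
    simp
    ring
  rw [h5, pow_add]
  linear_combination X ^ (j * (j - 1)) * h4

/-- Replacing `q ^ j ^ 2` by means of `modX_res_sq` raises the residue to its cube, producing
`cubicSum N 4`. -/
lemma modX_sum_res {N : ℕ} (hN : 1 ≤ N) :
    modX (N + 1) (∑ n ∈ Icc 1 N, qPoch X X n * lam n * hsymm lam (Icc n N) 3) =
      modX (N + 1) (hsymm lam (Icc 1 N) 4 - cubicSum N 4) := by
  rw [sum_qPoch_mul_lam_mul_hsymm, ← sum_res_mul_pow hN, cubicSum, ← sum_sub_distrib, map_sum,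
    map_sum]
  refine sum_congr rfl fun j hj => ?_
  rw [mem_Icc] at hj
  have h := modX_mul_left (c := res N j * lam j ^ 4) (i := j * 4) (M' := N + 1)
    ((X_pow_dvd_lam_pow j 4).mul_left _) (modX_res_sq (by omega) hj.2) (by omega)
  rw [mul_sub, map_sub, ← h, ← map_sub]
  congr 1
  ring

end HigherSpt

/-! ### A finite Jacobi triple product and the arithmetic of its coefficients. -/

namespace HigherSpt

open Finset PowerSeries

/-- The polynomials in `u = z + 1 / z - 2` given by `(z ^ (n + 1) - z ^ (-n)) / (z - 1)`. -/
noncomputable def thetaPoly : ℕ → ℤ⟦X⟧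
  | 0 => 1
  | 1 => X + C 3
  | n + 2 => (X + C 2) * thetaPoly (n + 1) - thetaPoly n

lemma coeff_thetaPoly_zero (n : ℕ) : coeff 0 (thetaPoly n) = 2 * n + 1 := by
  induction n using thetaPoly.induct with
  | case1 => simp [thetaPoly]
  | case2 =>
    simp only [thetaPoly, map_add, coeff_X, coeff_C]
    norm_num
  | case3 n h1 h2 =>
    rw [thetaPoly, add_mul, map_sub, map_add, coeff_zero_X_mul,
      coeff_C_mul, h1, h2]
    push_cast
    ring

lemma coeff_thetaPoly_succ (n k : ℕ) : coeff (k + 1) (thetaPoly (n + 2)) =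
    coeff k (thetaPoly (n + 1)) + 2 * coeff (k + 1) (thetaPoly (n + 1)) -
      coeff (k + 1) (thetaPoly n) := by
  rw [thetaPoly, add_mul, map_sub, map_add, coeff_succ_X_mul,
    coeff_C_mul]

/-- The instances `k = 1, 2, 3, 4` of the coefficient `(2n+1) (n+k)! / ((n-k)! (2k+1)!)` of `u^k`,
checked through the three-term recurrence. -/
lemma coeff_thetaPoly_closed (n : ℕ) :
    6 * coeff 1 (thetaPoly n) = n * (n + 1) * (2 * n + 1 : ℤ) ∧
    120 * coeff 2 (thetaPoly n) = (n - 1) * n * (n + 1) * (n + 2) * (2 * n + 1 : ℤ) ∧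
    5040 * coeff 3 (thetaPoly n) =
      (n - 2) * (n - 1) * n * (n + 1) * (n + 2) * (n + 3) * (2 * n + 1 : ℤ) ∧
    362880 * coeff 4 (thetaPoly n) =
      (n - 3) * (n - 2) * (n - 1) * n * (n + 1) * (n + 2) * (n + 3) * (n + 4) *
        (2 * n + 1 : ℤ) := by
  induction n using thetaPoly.induct with
  | case1 => simp [thetaPoly, coeff_one]
  | case2 =>
    simp only [thetaPoly, map_add, coeff_X, coeff_C]
    norm_num
  | case3 n h1 h2 =>
    obtain ⟨a1, a2, a3, a4⟩ := h1
    obtain ⟨b1, b2, b3, b4⟩ := h2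
    have a0 := coeff_thetaPoly_zero (n + 1)
    push_cast at a0 a1 a2 a3 a4 ⊢
    have s1 := coeff_thetaPoly_succ n 0
    have s2 := coeff_thetaPoly_succ n 1
    have s3 := coeff_thetaPoly_succ n 2
    have s4 := coeff_thetaPoly_succ n 3
    norm_num only at s1 s2 s3 s4
    refine ⟨?_, ?_, ?_, ?_⟩
    · linear_combination 6 * s1 + 6 * a0 + 2 * a1 - b1
    · linear_combination 120 * s2 + 20 * a1 + 2 * a2 - b2
    · linear_combination 5040 * s3 + 42 * a2 + 2 * a3 - b3
    · linear_combination 362880 * s4 + 72 * a3 + 2 * a4 - b4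

/-- The coefficients of `thetaPoly n`, modulo `3`. -/
noncomputable def thetaCoeff (n k : ℕ) : ZMod 3 := (coeff k (thetaPoly n) : ℤ)

/-- The triangular numbers. -/
def tri (n : ℕ) : ℕ := n * (n + 1) / 2

lemma two_mul_tri (n : ℕ) : 2 * tri n = n * (n + 1) :=
  Nat.mul_div_cancel' (Nat.even_mul_succ_self n).two_dvd

lemma tri_succ (n : ℕ) : tri (n + 1) = tri n + (n + 1) := by
  have h1 := two_mul_tri n
  have h2 := two_mul_tri (n + 1)
  nlinarith

/-- Consecutive coefficients have ratio `(tri n - tri k) / ((k+1)(2k+3))`, with denominators `10,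
21, 36` for `k = 1, 2, 3`; the last two vanish modulo 3. Since `tri n` is also the exponent of `q`
in the theta series, these become differential equations. -/
lemma thetaCoeff_heat (n : ℕ) :
    thetaCoeff n 2 = (tri n - 1) * thetaCoeff n 1 ∧ tri n * thetaCoeff n 2 = 0 ∧
      tri n * thetaCoeff n 3 = 0 := by
  obtain ⟨a1, a2, a3, a4⟩ := coeff_thetaPoly_closed n
  have ht : (2 : ℤ) * tri n = n * (n + 1) := by exact_mod_cast two_mul_tri n
  have h1 : 10 * coeff 2 (thetaPoly n) = (tri n - 1) * coeff 1 (thetaPoly n) := by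
    have : 12 * (10 * coeff 2 (thetaPoly n)) = 12 * ((tri n - 1) * coeff 1 (thetaPoly n)) := by
      linear_combination a2 - 2 * (tri n - 1) * a1 - n * (n + 1) * (2 * n + 1) * ht
    linarith
  have h2 : 21 * coeff 3 (thetaPoly n) = (tri n - 3) * coeff 2 (thetaPoly n) := by
    have : 240 * (21 * coeff 3 (thetaPoly n)) = 240 * ((tri n - 3) * coeff 2 (thetaPoly n)) := by
      linear_combination a3 - 2 * (tri n - 3) * a2 -
        (n - 1) * n * (n + 1) * (n + 2) * (2 * n + 1) * ht
    linarith
  have h3 : 36 * coeff 4 (thetaPoly n) = (tri n - 6) * coeff 3 (thetaPoly n) := by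
    have : 10080 * (36 * coeff 4 (thetaPoly n)) = 10080 * ((tri n - 6) * coeff 3 (thetaPoly n)) := by
      linear_combination a4 - 2 * (tri n - 6) * a3 -
        (n - 2) * (n - 1) * n * (n + 1) * (n + 2) * (n + 3) * (2 * n + 1) * ht
    linarith
  have e3 : (3 : ZMod 3) = 0 := by decide
  have h1' := congrArg (Int.cast : ℤ → ZMod 3) h1
  have h2' := congrArg (Int.cast : ℤ → ZMod 3) h2
  have h3' := congrArg (Int.cast : ℤ → ZMod 3) h3
  push_cast at h1' h2' h3'
  unfold thetaCoeff
  refine ⟨?_, ?_, ?_⟩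
  · linear_combination h1' - 3 * ((coeff 2 (thetaPoly n) : ℤ) : ZMod 3) * e3
  · linear_combination -h2' + (((coeff 2 (thetaPoly n) : ℤ) : ZMod 3) + 7 * ((coeff 3 (thetaPoly n) : ℤ) : ZMod 3)) * e3
  · linear_combination -h3' + (2 * ((coeff 3 (thetaPoly n) : ℤ) : ZMod 3) + 12 * ((coeff 4 (thetaPoly n) : ℤ) : ZMod 3)) * e3

section

variable {R : Type*} [CommRing R]

/-- The polynomials `thetaPoly n` over the ring `R`. -/
noncomputable def thetaPolyMap (R : Type*) [CommRing R] (n : ℕ) : R⟦X⟧ :=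
  PowerSeries.map (Int.castRingHom R) (thetaPoly n)

lemma X_add_two_mul_thetaPolyMap (n : ℕ) :
    (X + 2) * thetaPolyMap R (n + 1) = thetaPolyMap R (n + 2) + thetaPolyMap R n := by
  simp only [thetaPolyMap, thetaPoly, map_sub, map_mul, map_add, map_X, map_ofNat]
  ring

lemma X_add_two_mul_thetaPolyMap_zero :
    (X + 2) * thetaPolyMap R 0 = thetaPolyMap R 1 - thetaPolyMap R 0 := by
  simp only [thetaPolyMap, thetaPoly, map_add, map_X, map_ofNat, map_one]
  ring

/-- Summation by parts for the three-term recurrence. The sign of `a 0` reflects the convention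
`thetaPoly (-1) = -thetaPoly 0`. -/
lemma X_add_two_mul_sum (a : ℕ → R⟦X⟧) (K : ℕ) :
    (X + 2) * ∑ n ∈ range (K + 1), a n * thetaPolyMap R n =
      (a 1 - a 0) * thetaPolyMap R 0 +
        ∑ n ∈ range K, (a n + a (n + 2)) * thetaPolyMap R (n + 1) +
          a K * thetaPolyMap R (K + 1) - a (K + 1) * thetaPolyMap R K := by
  induction K with
  | zero =>
    simp only [zero_add, range_one, sum_singleton, range_zero, sum_empty]
    linear_combination a 0 * X_add_two_mul_thetaPolyMap_zero (R := R)
  | succ K ih =>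
    rw [sum_range_succ, mul_add, ih, sum_range_succ _ K]
    linear_combination a (K + 1) * X_add_two_mul_thetaPolyMap (R := R) K

end

/-- The coefficients of the finite form of the triple product identity. -/
noncomputable def tripleCoeff (N n : ℕ) : (ZMod 3)⟦X⟧ :=
  if n ≤ N then (-1) ^ n * X ^ tri n * qPoch X X (2 * N + 1) * (qPoch X X (N - n))⁻¹ *
    (qPoch X X (N + n + 1))⁻¹ else 0

lemma qPoch_inv_succ (n : ℕ) : ((qPoch X X n : (ZMod 3)⟦X⟧))⁻¹ =
    (1 - X ^ (n + 1)) * (qPoch X X (n + 1) : (ZMod 3)⟦X⟧)⁻¹ := by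
  have h1 : constantCoeff (qPoch X X n : (ZMod 3)⟦X⟧) ≠ 0 := by simp [qPoch, map_prod]
  have h2 : constantCoeff (qPoch X X (n + 1) : (ZMod 3)⟦X⟧) ≠ 0 := by simp [qPoch, map_prod]
  rw [PowerSeries.inv_eq_iff_mul_eq_one h1, mul_right_comm]
  have h3 : (1 - X ^ (n + 1)) * qPoch X X n = (qPoch X X (n + 1) : (ZMod 3)⟦X⟧) := by
    rw [qPoch_succ, pow_succ']
    ring
  rw [h3, PowerSeries.mul_inv_cancel _ h2]

lemma tripleCoeff_eq_zero {N n : ℕ} (h : N < n) : tripleCoeff N n = 0 := by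
  rw [tripleCoeff, if_neg (by omega)]

lemma qPoch_two_mul_succ (N : ℕ) : (qPoch X X (2 * (N + 1) + 1) : (ZMod 3)⟦X⟧) =
    qPoch X X (2 * N + 1) * (1 - X ^ (2 * N + 2)) * (1 - X ^ (2 * N + 3)) := by
  rw [show 2 * (N + 1) + 1 = 2 * N + 1 + 1 + 1 by ring, qPoch_succ, qPoch_succ]
  ring

lemma tripleCoeff_succ_zero (N : ℕ) :
    tripleCoeff (N + 1) 0 = (1 + X ^ (2 * (N + 1))) * tripleCoeff N 0 -
      X ^ (N + 1) * (tripleCoeff N 1 - tripleCoeff N 0) := by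
  have h1 : tripleCoeff (N + 1) 0 = qPoch X X (2 * N + 1) * (1 - X ^ (2 * N + 2)) *
      (1 - X ^ (2 * N + 3)) * (qPoch X X (N + 1))⁻¹ * (qPoch X X (N + 2))⁻¹ := by
    rw [tripleCoeff, if_pos (by omega), qPoch_two_mul_succ]
    simp [tri]
  have h2 : tripleCoeff N 0 = qPoch X X (2 * N + 1) * ((1 - X ^ (N + 1)) * (qPoch X X (N + 1))⁻¹) *
      ((1 - X ^ (N + 2)) * (qPoch X X (N + 2))⁻¹) := by
    rw [← qPoch_inv_succ, ← qPoch_inv_succ, tripleCoeff, if_pos (by omega)]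
    simp [tri]
  have h3 : tripleCoeff N 1 = -(X * (1 - X ^ N) * qPoch X X (2 * N + 1) *
      ((1 - X ^ (N + 1)) * (qPoch X X (N + 1))⁻¹) * (qPoch X X (N + 2))⁻¹) := by
    rcases N with - | N
    · rw [tripleCoeff_eq_zero (by omega)]
      simp
    · rw [tripleCoeff, if_pos (by omega), Nat.add_sub_cancel, qPoch_inv_succ N,
        qPoch_inv_succ (N + 1)]
      simp only [tri]
      ring
  rw [h1, h2, h3]
  ring

lemma tripleCoeff_succ_succ (N n : ℕ) (hn : n ≤ N) :
    tripleCoeff (N + 1) (n + 1) = (1 + X ^ (2 * (N + 1))) * tripleCoeff N (n + 1) -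
      X ^ (N + 1) * (tripleCoeff N n + tripleCoeff N (n + 2)) := by
  obtain ⟨d, rfl⟩ := Nat.exists_eq_add_of_le hn
  have h1 : tripleCoeff (n + d + 1) (n + 1) = (-1) ^ (n + 1) * X ^ tri (n + 1) *
      (qPoch X X (2 * (n + d) + 1) * (1 - X ^ (2 * (n + d) + 2)) * (1 - X ^ (2 * (n + d) + 3))) *
        (qPoch X X d)⁻¹ * (qPoch X X (2 * n + d + 3))⁻¹ := by
    rw [tripleCoeff, if_pos (by omega), qPoch_two_mul_succ,
      show n + d + 1 - (n + 1) = d by omega, show n + d + 1 + (n + 1) + 1 = 2 * n + d + 3 by omega]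
  have h2 : tripleCoeff (n + d) n = (-1) ^ n * X ^ tri n * qPoch X X (2 * (n + d) + 1) *
      (qPoch X X d)⁻¹ * ((1 - X ^ (2 * n + d + 2)) * ((1 - X ^ (2 * n + d + 3)) *
        (qPoch X X (2 * n + d + 3))⁻¹)) := by
    rw [← qPoch_inv_succ, ← qPoch_inv_succ, tripleCoeff, if_pos (by omega),
      show n + d - n = d by omega, show n + d + n + 1 = 2 * n + d + 1 by omega]
  have h3 : tripleCoeff (n + d) (n + 1) = (-1) ^ (n + 1) * X ^ tri (n + 1) *
      qPoch X X (2 * (n + d) + 1) * ((1 - X ^ d) * (qPoch X X d)⁻¹) *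
        ((1 - X ^ (2 * n + d + 3)) * (qPoch X X (2 * n + d + 3))⁻¹) := by
    rw [← qPoch_inv_succ]
    rcases d with - | d
    · rw [tripleCoeff_eq_zero (by omega)]
      simp
    · rw [← qPoch_inv_succ, tripleCoeff, if_pos (by omega),
        show n + (d + 1) - (n + 1) = d by omega,
        show n + (d + 1) + (n + 1) + 1 = 2 * n + (d + 1) + 2 by omega]
  -- The extra factor `X` replaces `1 - X ^ (d - 1)` by `X - X ^ d`, so that the formula also covers
  -- `d = 0` and `d = 1`, where both sides vanish.
  have h4 : X * tripleCoeff (n + d) (n + 2) = (-1) ^ n * X ^ tri (n + 2) *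
      qPoch X X (2 * (n + d) + 1) * ((X - X ^ d) * (1 - X ^ d) * (qPoch X X d)⁻¹) *
        (qPoch X X (2 * n + d + 3))⁻¹ := by
    rcases d with - | - | d
    · rw [tripleCoeff_eq_zero (by omega)]
      simp
    · rw [tripleCoeff_eq_zero (by omega)]
      simp
    · have e : ((X - X ^ (d + 1 + 1)) * (1 - X ^ (d + 1 + 1)) * (qPoch X X (d + 1 + 1))⁻¹ :
          (ZMod 3)⟦X⟧) = X * (qPoch X X d)⁻¹ := by
        rw [qPoch_inv_succ d, qPoch_inv_succ (d + 1)]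
        ring
      rw [e, tripleCoeff, if_pos (by omega), show n + (d + 1 + 1) - (n + 2) = d by omega,
        show n + (d + 1 + 1) + (n + 2) + 1 = 2 * n + (d + 1 + 1) + 3 by omega]
      ring
  have hX : (X : (ZMod 3)⟦X⟧) ≠ 0 := X_ne_zero
  apply mul_left_cancel₀ hX
  rw [tri_succ (n + 1)] at h4
  rw [h1, h2, h3]
  rw [tri_succ n] at h4 ⊢
  linear_combination X ^ (n + d + 1) * h4

/-- A finite form of Jacobi's triple product identity. -/
lemma prod_eq_sum_tripleCoeff (N : ℕ) :
    ∏ m ∈ Icc 1 N, (C ((1 - X ^ m) ^ 2) - C (X ^ m) * X : (ZMod 3)⟦X⟧⟦X⟧) =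
      ∑ n ∈ range (N + 1), C (tripleCoeff N n) * thetaPolyMap _ n := by
  induction N with
  | zero =>
    have h : tripleCoeff 0 0 = 1 := by
      have : (1 - X : (ZMod 3)⟦X⟧) * (1 - X)⁻¹ = 1 := PowerSeries.mul_inv_cancel _ (by simp)
      simp [tripleCoeff, tri, qPoch, this]
    simp [h, thetaPolyMap, thetaPoly]
  | succ N ih =>
    rw [prod_Icc_succ_top (by omega), ih]
    have h1 := X_add_two_mul_sum (fun n => C (tripleCoeff N n)) (N + 1)
    rw [sum_range_succ, tripleCoeff_eq_zero (N := N) (n := N + 1) (by omega),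
      tripleCoeff_eq_zero (N := N) (n := N + 1 + 1) (by omega)] at h1
    simp only [map_zero, zero_mul, add_zero, sub_zero] at h1
    have h2 : (C ((1 - X ^ (N + 1)) ^ 2) - C (X ^ (N + 1)) * X : (ZMod 3)⟦X⟧⟦X⟧) =
        C (1 + X ^ (2 * (N + 1))) - C (X ^ (N + 1)) * (X + 2) := by
      rw [← map_ofNat C 2]
      have : ((1 - X ^ (N + 1)) ^ 2 : (ZMod 3)⟦X⟧) = 1 + X ^ (2 * (N + 1)) - X ^ (N + 1) * 2 := by
        ring
      rw [this, map_sub, map_mul]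
      ring
    have h4 : ∑ n ∈ range (N + 1), C (tripleCoeff (N + 1) (n + 1)) *
        thetaPolyMap (ZMod 3)⟦X⟧ (n + 1) = ∑ n ∈ range (N + 1), C ((1 + X ^ (2 * (N + 1))) *
          tripleCoeff N (n + 1) - X ^ (N + 1) * (tripleCoeff N n + tripleCoeff N (n + 2))) *
            thetaPolyMap (ZMod 3)⟦X⟧ (n + 1) :=
      sum_congr rfl fun n hn => by
        rw [tripleCoeff_succ_succ N n (by rw [mem_range] at hn; omega)]
    rw [h2, mul_comm, sub_mul, mul_assoc, h1, sum_range_succ' _ (N + 1), tripleCoeff_succ_zero, h4]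
    have h3 : ∑ n ∈ range (N + 1), C (tripleCoeff N n) * thetaPolyMap (ZMod 3)⟦X⟧ n =
        ∑ n ∈ range (N + 1), C (tripleCoeff N (n + 1)) * thetaPolyMap (ZMod 3)⟦X⟧ (n + 1) +
          C (tripleCoeff N 0) * thetaPolyMap (ZMod 3)⟦X⟧ 0 := by
      rw [← sum_range_succ' (fun n => C (tripleCoeff N n) * thetaPolyMap (ZMod 3)⟦X⟧ n),
        sum_range_succ _ (N + 1), tripleCoeff_eq_zero (N := N) (n := N + 1) (by omega)]
      simp
    rw [h3]
    simp only [map_sub, map_mul, map_add, sub_mul, sum_sub_distrib, mul_assoc, ← mul_sum, add_mul,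
      sum_add_distrib]
    ring

end HigherSpt

/-! ### Theta series for the elementary symmetric functions. -/

namespace HigherSpt

open Finset PowerSeries

lemma qPoch_eq_prod (N : ℕ) : (qPoch X X N : (ZMod 3)⟦X⟧) = ∏ m ∈ Icc 1 N, (1 - X ^ m) := by
  induction N with
  | zero => simp [qPoch]
  | succ N ih => rw [qPoch_succ, ih, prod_Icc_succ_top (by omega), pow_succ']

lemma prod_eq_qPoch_sq_mul (N : ℕ) :
    ∏ m ∈ Icc 1 N, (C ((1 - X ^ m) ^ 2) - C (X ^ m) * X : (ZMod 3)⟦X⟧⟦X⟧) =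
      C (qPoch X X N ^ 2) * ∏ m ∈ Icc 1 N, (1 - C (lam m) * X) := by
  rw [qPoch_eq_prod, ← prod_pow, map_prod, ← prod_mul_distrib]
  refine prod_congr rfl fun m hm => ?_
  rw [mem_Icc] at hm
  have h : (1 - X ^ m) ^ 2 * lam m = X ^ m := by
    rw [lam]
    linear_combination X ^ m * (geomQ m * (1 - X ^ m) + 1) * geomQ_mul (r := m) (by omega)
  rw [mul_sub, mul_one, ← mul_assoc, ← map_mul, h]

/-- The signed elementary symmetric functions of `lam 1, …, lam N`. -/
noncomputable abbrev esymmLam (N k : ℕ) : (ZMod 3)⟦X⟧ := signedEsymm lam (Icc 1 N) k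

lemma qPoch_sq_mul_esymmLam (N k : ℕ) :
    qPoch X X N ^ 2 * esymmLam N k = ∑ n ∈ range (N + 1), tripleCoeff N n * C (thetaCoeff n k) := by
  have h := congrArg (coeff k) ((prod_eq_qPoch_sq_mul N).symm.trans (prod_eq_sum_tripleCoeff N))
  rw [coeff_C_mul, map_sum] at h
  rw [esymmLam, signedEsymm, h]
  refine sum_congr rfl fun n _ => ?_
  rw [coeff_C_mul, thetaPolyMap, coeff_map, thetaCoeff]
  congr 1
  simp

/-- The truncated theta series `∑ (-1) ^ n a(n, k) q ^ (n (n + 1) / 2)`. -/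
noncomputable def thetaSum (N k : ℕ) : (ZMod 3)⟦X⟧ :=
  ∑ n ∈ range (N + 1), C ((-1) ^ n * thetaCoeff n k) * X ^ tri n

lemma le_tri (n : ℕ) : n ≤ tri n := by
  have := two_mul_tri n
  nlinarith

/-- The quotient of shifted factorials is `1` modulo `X ^ (N - n + 1)`, and `X ^ tri n` supplies the
missing orders because `n ≤ tri n`. -/
lemma modX_qPoch_mul_tripleCoeff {N n : ℕ} (hn : n ≤ N) :
    modX (N + 1) (qPoch X X N * tripleCoeff N n) = modX (N + 1) ((-1) ^ n * X ^ tri n) := by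
  have hc : ∀ n, constantCoeff (qPoch X X n : (ZMod 3)⟦X⟧) ≠ 0 := fun n => by simp [qPoch, map_prod]
  have hu := (isUnit_qPoch (N - n)).map (modX (N - n + 1))
  have key : modX (N - n + 1) (qPoch X X N * qPoch X X (2 * N + 1) * (qPoch X X (N - n))⁻¹ *
      (qPoch X X (N + n + 1))⁻¹) = modX (N - n + 1) 1 := by
    have h1 : ∀ K, N - n ≤ K → modX (N - n + 1) (qPoch X X K) = modX (N - n + 1) (qPoch X X (N - n)) := by
      intro K hK
      obtain ⟨d, rfl⟩ := Nat.exists_eq_add_of_le hK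
      exact modX_qPoch le_rfl
    apply (hu.mul hu).mul_left_cancel
    have h2 : modX (N - n + 1) (qPoch X X (N - n)) * modX (N - n + 1) (qPoch X X (N - n)) =
        modX (N - n + 1) (qPoch X X (N - n) * qPoch X X (N + n + 1)) := by
      rw [map_mul, h1 (N + n + 1) (by omega)]
    rw [map_one, mul_one]
    nth_rewrite 1 [h2]
    rw [← map_mul]
    have h3 : (qPoch X X (N - n) * qPoch X X (N + n + 1) * (qPoch X X N * qPoch X X (2 * N + 1) *
        (qPoch X X (N - n))⁻¹ * (qPoch X X (N + n + 1))⁻¹) : (ZMod 3)⟦X⟧) =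
        qPoch X X N * qPoch X X (2 * N + 1) := by
      have e1 := PowerSeries.mul_inv_cancel _ (hc (N - n))
      have e2 := PowerSeries.mul_inv_cancel _ (hc (N + n + 1))
      generalize (qPoch X X (N - n) : (ZMod 3)⟦X⟧)⁻¹ = a at *
      generalize (qPoch X X (N + n + 1) : (ZMod 3)⟦X⟧)⁻¹ = b at *
      linear_combination qPoch X X N * qPoch X X (2 * N + 1) * (qPoch X X (N + n + 1) * b) * e1 +
        qPoch X X N * qPoch X X (2 * N + 1) * e2
    rw [h3, map_mul, h1 N (by omega), h1 (2 * N + 1) (by omega)]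
  have h4 := modX_mul_left (c := (-1) ^ n * X ^ tri n) (i := tri n) (M' := N + 1)
    (Dvd.intro_left _ rfl) key (by have := le_tri n; omega)
  rw [mul_one] at h4
  rw [← h4, tripleCoeff, if_pos hn]
  congr 1
  ring

lemma modX_qPoch_cube_mul_esymmLam (N k : ℕ) :
    modX (N + 1) (qPoch X X N ^ 3 * esymmLam N k) = modX (N + 1) (thetaSum N k) := by
  rw [pow_succ' (qPoch X X N) 2, mul_assoc, qPoch_sq_mul_esymmLam, mul_sum, thetaSum, map_sum, map_sum]
  refine sum_congr rfl fun n hn => ?_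
  rw [mem_range] at hn
  rw [← mul_assoc, map_mul, modX_qPoch_mul_tripleCoeff (by omega), ← map_mul]
  congr 1
  simp only [map_mul, map_pow, map_neg, map_one]
  ring

lemma eulerD_thetaSum (N k : ℕ) : eulerD (thetaSum N k) =
    ∑ n ∈ range (N + 1), C ((-1) ^ n * (tri n * thetaCoeff n k)) * X ^ tri n := by
  rw [thetaSum, map_sum]
  refine sum_congr rfl fun n _ => ?_
  rw [← smul_eq_C_mul, Derivation.map_smul, eulerD_X_pow, smul_eq_C_mul]
  simp only [map_mul, map_natCast]
  ring

lemma thetaSum_two (N : ℕ) : thetaSum N 2 = eulerD (thetaSum N 1) - thetaSum N 1 := by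
  rw [eulerD_thetaSum, thetaSum, thetaSum, ← sum_sub_distrib]
  refine sum_congr rfl fun n _ => ?_
  rw [(thetaCoeff_heat n).1, ← sub_mul, ← map_sub]
  congr 2
  ring

lemma eulerD_thetaSum_two (N : ℕ) : eulerD (thetaSum N 2) = 0 := by
  rw [eulerD_thetaSum]
  exact sum_eq_zero fun n _ => by simp [(thetaCoeff_heat n).2.1]

lemma eulerD_thetaSum_three (N : ℕ) : eulerD (thetaSum N 3) = 0 := by
  rw [eulerD_thetaSum]
  exact sum_eq_zero fun n _ => by simp [(thetaCoeff_heat n).2.2]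

lemma modX_qPoch_cube_cancel {M N : ℕ} {a b : (ZMod 3)⟦X⟧}
    (h : modX M (qPoch X X N ^ 3 * a) = modX M (qPoch X X N ^ 3 * b)) : modX M a = modX M b := by
  rw [map_mul, map_mul] at h
  exact (((isUnit_qPoch N).pow 3).map (modX M)).mul_left_cancel h

/-- The cube `qPoch X X N ^ 3` is a unit and a constant for `eulerD`, so the relations between theta
series pass to the symmetric functions. -/
lemma modX_esymmLam_two (N : ℕ) :
    modX (N + 1) (esymmLam N 2) = modX (N + 1) (eulerD (esymmLam N 1) - esymmLam N 1) := by
  apply modX_qPoch_cube_cancel (N := N)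
  rw [modX_qPoch_cube_mul_esymmLam, thetaSum_two, mul_sub, ← eulerD_cube_mul, map_sub, map_sub,
    modX_eulerD (modX_qPoch_cube_mul_esymmLam N 1), modX_qPoch_cube_mul_esymmLam]

lemma modX_eulerD_esymmLam_two (N : ℕ) : modX (N + 1) (eulerD (esymmLam N 2)) = modX (N + 1) 0 := by
  apply modX_qPoch_cube_cancel (N := N)
  rw [← eulerD_cube_mul, modX_eulerD (modX_qPoch_cube_mul_esymmLam N 2), eulerD_thetaSum_two,
    mul_zero]

lemma modX_eulerD_esymmLam_three (N : ℕ) :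
    modX (N + 1) (eulerD (esymmLam N 3)) = modX (N + 1) 0 := by
  apply modX_qPoch_cube_cancel (N := N)
  rw [← eulerD_cube_mul, modX_eulerD (modX_qPoch_cube_mul_esymmLam N 3), eulerD_thetaSum_three,
    mul_zero]

lemma modX_X_pow_mul_geomQ {m : ℕ} (hm : m ≠ 0) (N : ℕ) :
    modX (N + 1) (X ^ m * geomQ m) = modX (N + 1) (∑ r ∈ Icc 1 N, X ^ (m * r)) := by
  have h : ∀ K, ∑ r ∈ Icc 1 K, X ^ (m * r) = (X ^ m - X ^ (m * (K + 1))) * geomQ m := by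
    intro K
    induction K with
    | zero => simp
    | succ K ih =>
      rw [sum_Icc_succ_top (by omega), ih]
      linear_combination (-(X ^ (m * (K + 1)))) * geomQ_mul hm
  rw [modX_eq_iff, h, ← sub_mul, sub_sub_cancel]
  exact (pow_dvd_pow X (Nat.le_mul_of_pos_left _ (by omega))).mul_right _

lemma modX_lam_eq_sum {m : ℕ} (hm : m ≠ 0) (N : ℕ) :
    modX (N + 1) (lam m) = modX (N + 1) (∑ r ∈ Icc 1 N, (r : (ZMod 3)⟦X⟧) * X ^ (m * r)) := by
  have h : ∀ K : ℕ, ∑ r ∈ Icc 1 K, (r : (ZMod 3)⟦X⟧) * X ^ (m * r) =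
      (X ^ m - X ^ (m * (K + 1)) * ((K : (ZMod 3)⟦X⟧) + 1 - (K : (ZMod 3)⟦X⟧) * X ^ m)) * geomQ m ^ 2 := by
    intro K
    induction K with
    | zero => simp
    | succ K ih =>
      rw [sum_Icc_succ_top (by omega), ih]
      push_cast
      linear_combination (-(((K : (ZMod 3)⟦X⟧) + 1) * X ^ (m * (K + 1)) * (geomQ m * (1 - X ^ m) + 1))) *
        geomQ_mul hm
  rw [modX_eq_iff, h, lam, ← sub_mul, sub_sub_cancel, mul_assoc]
  exact (pow_dvd_pow X (Nat.le_mul_of_pos_left _ (by omega))).mul_right _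

lemma eulerD_qPoch (N : ℕ) : eulerD (qPoch X X N) =
    -(qPoch X X N * ∑ m ∈ Icc 1 N, (m : (ZMod 3)⟦X⟧) * (X ^ m * geomQ m)) := by
  induction N with
  | zero => simp [qPoch]
  | succ N ih =>
    rw [qPoch_succ, eulerD_mul, ih, sum_Icc_succ_top (by omega), ← pow_succ', map_sub,
      Derivation.map_one_eq_zero, eulerD_X_pow]
    linear_combination (qPoch X X N * ((N + 1 : ℕ) : (ZMod 3)⟦X⟧) * X ^ (N + 1)) *
      geomQ_mul (r := N + 1) (by omega)

/-- The logarithmic derivative is `∑ m q^m / (1 - q^m)`. Expanded as the double sum of `m q^(m r)`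
and summed over `m` first, it becomes the sum of the `lam r`. -/
lemma modX_eulerD_qPoch_inv (N : ℕ) :
    modX (N + 1) (eulerD (qPoch X X N)⁻¹) = modX (N + 1) (psumLam N 1 * (qPoch X X N)⁻¹) := by
  have h0 : (qPoch X X N : (ZMod 3)⟦X⟧) * (qPoch X X N)⁻¹ = 1 :=
    PowerSeries.mul_inv_cancel _ (by simp [qPoch, map_prod])
  have h1 := congrArg eulerD h0
  rw [eulerD_mul, eulerD_qPoch, Derivation.map_one_eq_zero] at h1
  have h2 : eulerD (qPoch X X N)⁻¹ =
      (∑ m ∈ Icc 1 N, (m : (ZMod 3)⟦X⟧) * (X ^ m * geomQ m)) * (qPoch X X N)⁻¹ := by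
    generalize (qPoch X X N : (ZMod 3)⟦X⟧)⁻¹ = F at *
    linear_combination F * h1 + (F * (∑ m ∈ Icc 1 N, (m : (ZMod 3)⟦X⟧) * (X ^ m * geomQ m)) -
      eulerD F) * h0
  have h3 : modX (N + 1) (∑ m ∈ Icc 1 N, (m : (ZMod 3)⟦X⟧) * (X ^ m * geomQ m)) =
      modX (N + 1) (psumLam N 1) := by
    have h4 : modX (N + 1) (∑ m ∈ Icc 1 N, (m : (ZMod 3)⟦X⟧) * (X ^ m * geomQ m)) =
        modX (N + 1) (∑ m ∈ Icc 1 N, ∑ r ∈ Icc 1 N, (m : (ZMod 3)⟦X⟧) * X ^ (m * r)) := by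
      rw [map_sum, map_sum]
      refine sum_congr rfl fun m hm => ?_
      rw [mem_Icc] at hm
      rw [map_mul, modX_X_pow_mul_geomQ (by omega), ← map_mul, mul_sum]
    rw [h4, sum_comm, psumLam, map_sum, map_sum]
    refine sum_congr rfl fun m hm => ?_
    rw [mem_Icc] at hm
    rw [pow_one, modX_lam_eq_sum (by omega)]
    simp only [mul_comm m]
  rw [h2, map_mul, h3, ← map_mul]

lemma esymmLam_one (N : ℕ) : esymmLam N 1 = -psumLam N 1 := by
  have h := sum_hsymm_mul_signedEsymm lam (Icc 1 N) 0
  simp only [sum_range_succ, range_zero, sum_empty, hsymm_zero, hsymm_one, zero_add, Nat.sub_self,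
    Nat.sub_zero, signedEsymm_zero] at h
  simp only [psumLam, pow_one]
  linear_combination h

lemma modX_eulerD_psumLam (N : ℕ) :
    modX (N + 1) (eulerD (psumLam N 1)) = modX (N + 1) (psumLam N 1 - esymmLam N 2) := by
  have h := modX_esymmLam_two N
  rw [esymmLam_one, map_neg] at h
  simp only [map_sub, map_neg] at h ⊢
  linear_combination h

/-- Put `D = eulerD`, `F = (qPoch X X N)⁻¹`, `e = psumLam N 1`, `c = esymmLam N 2`. From `D F = e
F`, `D e = e - c` and `D c = 0` one gets `D^3 F = (e^3 + e - c) F` modulo 3, and `D^3 F = D F = e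
F`. -/
lemma modX_esymmLam_two_eq_cube (N : ℕ) :
    modX (N + 1) (esymmLam N 2) = modX (N + 1) (psumLam N 1 ^ 3) := by
  have h1 := modX_eulerD_qPoch_inv N
  have h2 := modX_eulerD h1
  have he := modX_eulerD_psumLam N
  have hc := modX_eulerD_esymmLam_two N
  have h3 : modX (N + 1) (eulerD (eulerD (qPoch X X N)⁻¹)) = modX (N + 1)
      ((psumLam N 1 ^ 2 + psumLam N 1 - esymmLam N 2) * (qPoch X X N)⁻¹) := by
    rw [h2, eulerD_mul]
    simp only [map_mul, map_add, map_sub, map_pow] at h1 he ⊢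
    rw [h1, he]
    ring
  have h4 := modX_eulerD h3
  rw [eulerD_eulerD_eulerD, h1, eulerD_mul, map_sub eulerD, map_add eulerD,
    Derivation.leibniz_pow] at h4
  simp only [smul_eq_mul, nsmul_eq_mul, map_mul, map_add, map_sub, map_pow, map_natCast,
    map_zero] at h1 he hc h4
  rw [h1, he, hc] at h4
  have hu : IsUnit (modX (N + 1) (qPoch X X N)⁻¹) := by
    refine IsUnit.map _ ?_
    rw [PowerSeries.isUnit_iff_constantCoeff]
    simp [qPoch, map_prod]
  apply hu.mul_right_cancel
  rw [map_pow]
  have e3 : (3 : (ZMod 3)⟦X⟧ ⧸ Ideal.span {(X : (ZMod 3)⟦X⟧) ^ (N + 1)}) = 0 := by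
    rw [← map_ofNat (modX (N + 1)) 3, three_eq_zero, map_zero]
  push_cast at h4
  simp only [pow_one] at h4
  generalize modX (N + 1) (qPoch X X N)⁻¹ = F at *
  generalize modX (N + 1) (psumLam N 1) = e at *
  generalize modX (N + 1) (esymmLam N 2) = c at *
  linear_combination h4 + (e ^ 2 - e * c) * F * e3

end HigherSpt

/-! ### The generating function as a derivative. -/

namespace HigherSpt

open Finset PowerSeries

lemma hsymm_lam_two (N : ℕ) :
    hsymm lam (Icc 1 N) 2 = psumLam N 1 ^ 2 - esymmLam N 2 := by
  have h := sum_hsymm_mul_signedEsymm lam (Icc 1 N) 1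
  simp only [sum_range_succ, range_zero, sum_empty, hsymm_zero, hsymm_one, zero_add,
    Nat.reduceAdd, Nat.sub_self, Nat.sub_zero, Nat.reduceSub, signedEsymm_zero] at h
  have h1 := esymmLam_one N
  simp only [psumLam, pow_one] at h1 ⊢
  linear_combination h - (∑ m ∈ Icc 1 N, lam m) * h1

lemma hsymm_lam_three (N : ℕ) : hsymm lam (Icc 1 N) 3 =
    psumLam N 1 ^ 3 - 2 * psumLam N 1 * esymmLam N 2 - esymmLam N 3 := by
  have h := sum_hsymm_mul_signedEsymm lam (Icc 1 N) 2
  simp only [sum_range_succ, range_zero, sum_empty, hsymm_zero, hsymm_one, zero_add,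
    Nat.reduceAdd, Nat.sub_self, Nat.sub_zero, Nat.reduceSub, signedEsymm_zero,
    hsymm_lam_two] at h
  have h1 := esymmLam_one N
  simp only [psumLam, pow_one] at h h1 ⊢
  linear_combination h - ((∑ m ∈ Icc 1 N, lam m) ^ 2 - esymmLam N 2) * h1

lemma psumLam_two (N : ℕ) :
    psumLam N 2 = 2 * hsymm lam (Icc 1 N) 2 - psumLam N 1 ^ 2 := by
  have h := newton_hsymm lam (Icc 1 N) 1
  simp only [sum_range_succ, range_zero, sum_empty, hsymm_zero, hsymm_one, zero_add,
    Nat.reduceAdd, Nat.sub_self, Nat.sub_zero, pow_one] at h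
  push_cast at h
  simp only [psumLam, pow_one]
  linear_combination -h

lemma psumLam_four_eq (N : ℕ) :
    psumLam N 4 = hsymm lam (Icc 1 N) 4 - hsymm lam (Icc 1 N) 3 * psumLam N 1 -
      hsymm lam (Icc 1 N) 2 * psumLam N 2 - psumLam N 1 ^ 4 := by
  have h := newton_hsymm lam (Icc 1 N) 3
  have h3 : ∑ m ∈ Icc 1 N, lam m ^ 3 = psumLam N 1 ^ 3 := by
    simp only [psumLam, pow_one, sum_pow_three]
  simp only [sum_range_succ, range_zero, sum_empty, hsymm_zero, hsymm_one, zero_add,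
    Nat.reduceAdd, Nat.sub_self, Nat.sub_zero, Nat.reduceSub, pow_one, h3] at h
  push_cast at h
  simp only [psumLam, pow_one] at h ⊢
  linear_combination -h + hsymm lam (Icc 1 N) 4 * three_eq_zero

/-- Modulo `3`, the generating function of `spt_4` is a derivative. -/
lemma modX_exists_eulerD {N : ℕ} (hN : 1 ≤ N) : ∃ G : (ZMod 3)⟦X⟧,
    modX (N + 1) ((qPoch X X N)⁻¹ *
      ∑ n ∈ Icc 1 N, qPoch X X n * lam n * hsymm lam (Icc n N) 3) = modX (N + 1) (eulerD G) := by
  -- Applying `D + p_1` to `cubicSum N 1 + cubicSum N 3` gives `2 p_2 + p_4 + p_1^4 - p_1^3 -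
  -- cubicSum N 4`. By Newton's identities this is `h_4 - cubicSum N 4` plus a polynomial in `p_1`,
  -- `e_2 = p_1^3` and `e_3`. The remaining summands are chosen to cancel that polynomial.
  refine ⟨(qPoch X X N)⁻¹ * (cubicSum N 1 + cubicSum N 3 - esymmLam N 3 + 2 * psumLam N 1 ^ 3 +
    (1 + psumLam N 1 ^ 3) * (psumLam N 1 - 1)), ?_⟩
  have hD := modX_sum_res hN
  have h4 := modX_cubicSum_four hN
  have h2 := modX_cubicSum_two hN
  have h32 := congrArg (modX (N + 1)) (cubicSum_three_add_two hN)
  have hF := modX_eulerD_qPoch_inv N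
  have he := modX_eulerD_psumLam N
  have hc := modX_esymmLam_two_eq_cube N
  have hd := modX_eulerD_esymmLam_three N
  have e3 : (3 : (ZMod 3)⟦X⟧ ⧸ Ideal.span {(X : (ZMod 3)⟦X⟧) ^ (N + 1)}) = 0 := by
    rw [← map_ofNat (modX (N + 1)) 3, three_eq_zero, map_zero]
  have hcube : eulerD (2 * psumLam N 1 ^ 3) = 0 := by
    rw [mul_comm, eulerD_cube_mul]
    have : eulerD 2 = 0 := by exact_mod_cast Derivation.map_natCast eulerD 2
    rw [this, mul_zero]
  rw [eulerD_mul, map_add eulerD, map_add eulerD, map_sub eulerD, map_add eulerD, hcube,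
    eulerD_mul, map_add eulerD, map_sub eulerD, Derivation.map_one_eq_zero, eulerD_cube, map_mul, hD]
  rw [psumLam_four_eq, psumLam_two, hsymm_lam_three, hsymm_lam_two] at h4
  rw [psumLam_two, hsymm_lam_two] at h2
  simp only [map_add, map_sub, map_mul, map_pow, map_one, map_zero, map_ofNat] at *
  rw [hF, he, hd]
  rw [hc] at h4 h2 ⊢
  generalize modX (N + 1) (qPoch X X N)⁻¹ = F at *
  generalize modX (N + 1) (psumLam N 1) = e at *
  generalize modX (N + 1) (esymmLam N 3) = d at *
  generalize modX (N + 1) (hsymm lam (Icc 1 N) 4) = h at *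
  generalize modX (N + 1) (eulerD (cubicSum N 1)) = V1 at *
  generalize modX (N + 1) (eulerD (cubicSum N 3)) = V3 at *
  generalize modX (N + 1) (cubicSum N 1) = U1 at *
  generalize modX (N + 1) (cubicSum N 2) = U2 at *
  generalize modX (N + 1) (cubicSum N 3) = U3 at *
  generalize modX (N + 1) (cubicSum N 4) = U4 at *
  linear_combination F * (-h4 - h2 + h32) + F * (-e ^ 2 + 2 * e ^ 3 - 2 * e ^ 5 + e ^ 6) * e3

end HigherSpt

/-! ### The weight as a coefficient of a product over parts. -/

namespace HigherSpt

open Finset PowerSeries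

/-- The multiplicity function on `Fin d` which places the blocks of a composition at the
indices `j`. -/
def spread {k d : ℕ} (m : Composition k) (j : Fin m.length → Fin d) (t : Fin d) : ℕ :=
  ∑ i, if j i = t then m.blocksFun i else 0

lemma spread_apply {k d : ℕ} {m : Composition k} {j : Fin m.length → Fin d}
    (hj : StrictMono j) (i : Fin m.length) : spread m j (j i) = m.blocksFun i := by
  rw [spread, sum_eq_single i (fun b _ hb => if_neg (hj.injective.ne hb)) (by simp), if_pos rfl]

lemma spread_eq_zero {k d : ℕ} {m : Composition k} {j : Fin m.length → Fin d} {t : Fin d}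
    (ht : ∀ i, j i ≠ t) : spread m j t = 0 :=
  sum_eq_zero fun i _ => if_neg (ht i)

lemma spread_ne_zero_iff {k d : ℕ} {m : Composition k} {j : Fin m.length → Fin d}
    (hj : StrictMono j) {t : Fin d} : spread m j t ≠ 0 ↔ t ∈ univ.image j := by
  simp only [mem_image, mem_univ, true_and]
  constructor
  · intro h
    by_contra! hc
    exact h (spread_eq_zero hc)
  · rintro ⟨i, rfl⟩
    rw [spread_apply hj]
    exact (m.blocks_pos' _ i.2).ne'

lemma sum_spread {k d : ℕ} (m : Composition k) (j : Fin m.length → Fin d) :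
    ∑ t, spread m j t = k := by
  simp only [spread]
  rw [sum_comm]
  simp [m.sum_blocksFun]

/-- The support of the multiplicity function recovers the increasing indices, and its values there
recover the blocks. -/
lemma spread_injective {k d : ℕ} {m m' : Composition k} {j : Fin m.length → Fin d}
    {j' : Fin m'.length → Fin d} (hj : StrictMono j) (hj' : StrictMono j')
    (h : spread m j = spread m' j') :
    (⟨m, j⟩ : Σ m : Composition k, Fin m.length → Fin d) = ⟨m', j'⟩ := by
  have himg : univ.image j = univ.image j' := by
    ext t
    rw [← spread_ne_zero_iff hj, ← spread_ne_zero_iff hj', h]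
  have hcard : (univ.image j).card = m.length := by
    rw [card_image_of_injective _ hj.injective, card_univ, Fintype.card_fin]
  have hcard' : (univ.image j).card = m'.length := by
    rw [himg, card_image_of_injective _ hj'.injective, card_univ, Fintype.card_fin]
  have e := orderEmbOfFin_unique hcard (fun i => mem_image_of_mem j (mem_univ i)) hj
  have e' := orderEmbOfFin_unique hcard'
    (fun i => himg ▸ mem_image_of_mem j' (mem_univ i)) hj'
  have hlen : m.length = m'.length := hcard.symm.trans hcard'
  have hjj (i : Fin m.length) : j i = j' (Fin.cast hlen i) := by
    rw [congrFun e i, congrFun e' (Fin.cast hlen i), orderEmbOfFin_eq_orderEmbOfFin_iff]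
    rfl
  have hm : m = m' := by
    apply Composition.ext
    rw [← m.ofFn_blocksFun, ← m'.ofFn_blocksFun, List.ofFn_congr hlen]
    congr 1
    funext i
    rw [← spread_apply hj, ← spread_apply hj', h, hjj]
    rfl
  subst hm
  congr 1
  funext i
  exact hjj i

lemma exists_spread_eq {k d : ℕ} (g : Fin d → ℕ) (hg : ∑ t, g t = k) :
    ∃ (m : Composition k) (j : Fin m.length → Fin d), StrictMono j ∧ spread m j = g := by
  set s : Finset (Fin d) := univ.filter fun t => g t ≠ 0 with hs
  have hsum : ∑ i, g (s.orderEmbOfFin rfl i) = k := by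
    rw [← hg, ← sum_filter_ne_zero (s := univ) (f := g), ← hs, ← sum_coe_sort s g]
    exact Fintype.sum_equiv (s.orderIsoOfFin rfl).toEquiv _ _ (fun i => rfl)
  have hpos (i) : 0 < g (s.orderEmbOfFin rfl i) :=
    Nat.pos_of_ne_zero (mem_filter.1 (s.orderEmbOfFin_mem rfl i)).2
  let m : Composition k :=
    { blocks := List.ofFn fun i => g (s.orderEmbOfFin rfl i)
      blocks_pos := by
        intro x hx
        obtain ⟨i, rfl⟩ := (List.mem_ofFn' _ _).1 hx
        exact hpos i
      blocks_sum := by rw [List.sum_ofFn, hsum] }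
  have hlen : m.length = s.card := List.length_ofFn
  have hj : StrictMono fun i : Fin m.length => s.orderEmbOfFin rfl (Fin.cast hlen i) :=
    (s.orderEmbOfFin rfl).strictMono.comp (Fin.cast_strictMono hlen)
  refine ⟨m, _, hj, ?_⟩
  funext t
  by_cases ht : g t = 0
  · rw [ht]
    refine spread_eq_zero fun i hi => ?_
    exact (hpos (Fin.cast hlen i)).ne' (hi ▸ ht)
  · have hts : t ∈ s := by simp [hs, ht]
    obtain ⟨i, hi⟩ : ∃ i, s.orderEmbOfFin rfl i = t := by
      have : t ∈ Set.range (s.orderEmbOfFin rfl) := by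
        rw [range_orderEmbOfFin]; exact hts
      exact this
    have h2 := spread_apply hj (Fin.cast hlen.symm i)
    have h3 : s.orderEmbOfFin rfl (Fin.cast hlen (Fin.cast hlen.symm i)) = t := hi
    rw [h3] at h2
    rw [h2, ← hi]
    simp [Composition.blocksFun, m]

/-- A coefficient of a finite product of power series as a sum over compositions and strictly
increasing sequences of indices. -/
lemma sum_composition_prod {R : Type*} [CommSemiring R] {d : ℕ} (P : Fin d → ℕ → R) (k : ℕ) :
    ∑ m : Composition k, ∑ j : Fin m.length → Fin d with StrictMono j,
      ∏ t, P t (spread m j t) = coeff k (∏ t, mk (P t)) := by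
  rw [sum_sigma', coeff_prod]
  refine sum_bij (fun x _ => Finsupp.equivFunOnFinite.symm (spread x.1 x.2)) ?_ ?_ ?_ ?_
  · rintro ⟨m, j⟩ -
    simp [mem_finsuppAntidiag, sum_spread]
  · rintro ⟨m, j⟩ h ⟨m', j'⟩ h' e
    simp only [mem_sigma, mem_filter, mem_univ, true_and] at h h'
    exact spread_injective h h' (Finsupp.equivFunOnFinite.symm.injective e)
  · intro g hg
    obtain ⟨m, j, hj, e⟩ := exists_spread_eq g (mem_finsuppAntidiag.1 hg).1
    refine ⟨⟨m, j⟩, by simpa using hj, ?_⟩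
    ext t
    simp [e]
  · rintro ⟨m, j⟩ -
    simp

lemma prod_spread {R : Type*} [CommSemiring R] {k d : ℕ} {m : Composition k}
    {j : Fin m.length → Fin d} (hj : StrictMono j) (P : Fin d → ℕ → R)
    (hP : ∀ t, (∀ i, j i ≠ t) → P t 0 = 1) :
    ∏ t, P t (spread m j t) = ∏ i, P (j i) (m.blocksFun i) := by
  rw [← prod_subset (subset_univ (univ.image j)), prod_image hj.injective.injOn]
  · exact prod_congr rfl fun i _ => by rw [spread_apply hj]
  · intro t _ ht
    have : ∀ i, j i ≠ t := fun i hi => ht (mem_image.2 ⟨i, mem_univ i, hi⟩)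
    rw [spread_eq_zero this, hP t this]

/-- The factor contributed to the weight by a smallest part which occurs `c` times. -/
def smallestFactor (c m : ℕ) : ℕ := if m = 0 then 0 else (c + m - 1).choose (2 * m - 1)

/-- The factor contributed to the weight by a part which occurs `c` times and is not smallest. -/
def otherFactor (c m : ℕ) : ℕ := (c + m).choose (2 * m)

lemma smallestFactor_zero_right (c : ℕ) : smallestFactor c 0 = 0 := if_pos rfl

lemma smallestFactor_of_ne_zero (c : ℕ) {m : ℕ} (hm : m ≠ 0) :
    smallestFactor c m = (c + m - 1).choose (2 * m - 1) := if_neg hm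

lemma otherFactor_zero_right (c : ℕ) : otherFactor c 0 = 1 := by simp [otherFactor]

lemma composition_length_pos {k : ℕ} (hk : k ≠ 0) (m : Composition k) : 0 < m.length :=
  m.length_pos_of_pos (Nat.pos_of_ne_zero hk)

/-- Multiplicity functions of total `k` encode the composition together with the chosen indices. The
value `smallestFactor c 0 = 0` discards choices that omit the smallest part, while `otherFactor c 0
= 1` leaves unchosen parts without effect. -/
lemma weight_eq_coeff {k n : ℕ} (hk : k ≠ 0) (π : n.Partition)
    (hπ : 0 < π.parts.toFinset.card) (R : Type*) [CommSemiring R] :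
    (weight k π : R) = coeff k (∏ t : Fin π.parts.toFinset.card, mk fun m =>
      ((if (t : ℕ) = 0 then smallestFactor (freq π t) m
        else otherFactor (freq π t) m : ℕ) : R)) := by
  rw [← sum_composition_prod, weight, Nat.cast_sum]
  refine sum_congr rfl fun m _ => ?_
  have hm := composition_length_pos hk m
  rw [Nat.cast_sum]
  refine sum_subset_zero_on_sdiff ?_ ?_ ?_
  · intro j hj
    simp only [mem_filter, mem_univ, true_and] at hj ⊢
    exact fun a b hab => hj.1 a b hab
  · intro j hj
    simp only [mem_sdiff, mem_filter, mem_univ, true_and, not_and] at hj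
    obtain ⟨hmono, h0⟩ := hj
    refine prod_eq_zero (mem_univ (⟨0, hπ⟩ : Fin π.parts.toFinset.card)) ?_
    rw [if_pos rfl, spread_eq_zero, smallestFactor_zero_right, Nat.cast_zero]
    intro i hi
    refine h0 (fun a b hab => hmono hab) fun i' hi' => ?_
    have h1 : j i' ≤ j i := hmono.monotone (Fin.le_def.2 (by omega))
    rw [hi, Fin.le_def] at h1
    exact Nat.le_zero.1 h1
  · intro j hj
    simp only [mem_filter, mem_univ, true_and] at hj
    have hmono : StrictMono j := fun a b hab => hj.1 a b hab
    rw [prod_spread hmono (fun t m => ((if (t : ℕ) = 0 then smallestFactor (freq π t) m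
      else otherFactor (freq π t) m : ℕ) : R)), Nat.cast_prod]
    · refine prod_congr rfl fun i _ => ?_
      by_cases hi : (i : ℕ) = 0
      · rw [if_pos hi, if_pos (hj.2 i hi), smallestFactor_of_ne_zero _ (Nat.one_le_iff_ne_zero.1 (m.one_le_blocksFun i))]
      · have : (j i : ℕ) ≠ 0 := by
          have h1 : j ⟨0, hm⟩ < j i := hmono (Fin.lt_def.2 (Nat.pos_of_ne_zero hi))
          exact (lt_of_le_of_lt (Nat.zero_le _) (Fin.lt_def.1 h1)).ne'
        rw [if_neg hi, if_neg this, otherFactor]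
    · intro t ht
      have : (t : ℕ) ≠ 0 := fun h => ht ⟨0, hm⟩ (Fin.ext ((hj.2 ⟨0, hm⟩ rfl).trans h.symm))
      rw [if_neg this, otherFactor_zero_right, Nat.cast_one]

lemma weight_eq_zero {k n : ℕ} (hk : k ≠ 0) (π : n.Partition)
    (hπ : π.parts.toFinset.card = 0) : weight k π = 0 := by
  refine sum_eq_zero fun m _ => sum_eq_zero fun j _ => ?_
  have := (j ⟨0, composition_length_pos hk m⟩).2
  omega

/-- The factor of the part `i` in the weight of a partition with smallest part `a`, when `i`
occurs `c` times, as a power series in the marking variable. -/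
noncomputable def partFactor (R : Type*) [CommSemiring R] (a i c : ℕ) : R⟦X⟧ :=
  if i < a then (if c = 0 then 1 else 0)
  else if i = a then mk fun m => (smallestFactor c m : R)
  else mk fun m => (otherFactor c m : R)

lemma mk_smallestFactor_zero (R : Type*) [CommSemiring R] :
    (mk fun m => (smallestFactor 0 m : R)) = 0 := by
  ext m
  rw [coeff_mk, map_zero]
  by_cases hm : m = 0
  · rw [hm, smallestFactor_zero_right, Nat.cast_zero]
  · rw [smallestFactor_of_ne_zero _ hm, Nat.choose_eq_zero_of_lt (by omega), Nat.cast_zero]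

lemma mk_otherFactor_zero (R : Type*) [CommSemiring R] :
    (mk fun m => (otherFactor 0 m : R)) = 1 := by
  ext m
  rw [coeff_mk, coeff_one]
  by_cases hm : m = 0
  · rw [hm, otherFactor_zero_right, Nat.cast_one, if_pos rfl]
  · rw [otherFactor, Nat.choose_eq_zero_of_lt (by omega), Nat.cast_zero, if_neg hm]

/-- Only the true smallest part survives in the sum over `a`: a value `a` that does not occur gives
a zero factor at `a`, and a larger part gives one at the minimum. The product then runs over a range
independent of the partition. -/
lemma weight_eq_coeff_sum {k n N : ℕ} (hk : k ≠ 0) (hn : n ≤ N) (π : n.Partition)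
    (R : Type*) [CommSemiring R] :
    (weight k π : R) = coeff k (∑ a ∈ Icc 1 N, ∏ i ∈ Icc 1 N,
      partFactor R a i (π.parts.count i)) := by
  have hsub : π.parts.toFinset ⊆ Icc 1 N := by
    intro i hi
    rw [Multiset.mem_toFinset] at hi
    exact mem_Icc.2 ⟨π.parts_pos hi, (π.le_of_mem_parts hi).trans hn⟩
  have hvan {a : ℕ} (ha : a ∈ Icc 1 N) (h : a ∉ π.parts.toFinset) :
      ∏ i ∈ Icc 1 N, partFactor R a i (π.parts.count i) = 0 := by
    refine prod_eq_zero ha ?_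
    rw [Multiset.mem_toFinset] at h
    rw [partFactor, if_neg (lt_irrefl a), if_pos rfl, Multiset.count_eq_zero_of_notMem h,
      mk_smallestFactor_zero]
  rcases Nat.eq_zero_or_pos π.parts.toFinset.card with h0 | hpos
  · rw [weight_eq_zero hk π h0, Nat.cast_zero, sum_eq_zero, map_zero]
    intro a ha
    exact hvan ha (by rw [card_eq_zero.1 h0]; exact notMem_empty a)
  · rw [weight_eq_coeff hk π hpos]
    congr 1
    have hz := orderEmbOfFin_zero (s := π.parts.toFinset) rfl hpos
    set a := π.parts.toFinset.min' (card_pos.mp hpos) with ha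
    have hmem : a ∈ π.parts.toFinset := min'_mem _ _
    rw [sum_eq_single a]
    · rw [← prod_subset hsub]
      · conv_rhs => rw [← map_orderEmbOfFin_univ π.parts.toFinset rfl, prod_map]
        refine prod_congr rfl fun t _ => ?_
        simp only [RelEmbedding.coe_toEmbedding]
        by_cases ht : (t : ℕ) = 0
        · have : t = ⟨0, hpos⟩ := Fin.ext ht
          subst this
          simp only [if_true, partFactor, hz, lt_irrefl, if_false, freq]
        · have h1 : a < π.parts.toFinset.orderEmbOfFin rfl t := by
            rw [← hz]
            exact (orderEmbOfFin _ rfl).strictMono (Fin.lt_def.2 (Nat.pos_of_ne_zero ht))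
          simp only [if_neg ht, partFactor, if_neg h1.not_gt, if_neg h1.ne', freq]
      · intro i _ hi
        have hc : π.parts.count i = 0 :=
          Multiset.count_eq_zero_of_notMem (by rwa [Multiset.mem_toFinset] at hi)
        have hia : i ≠ a := fun h => hi (h ▸ hmem)
        rw [partFactor, hc, if_neg hia, mk_otherFactor_zero, if_pos rfl, ite_self]
    · intro b hb hba
      by_cases hbm : b ∈ π.parts.toFinset
      · have hlt : a < b := lt_of_le_of_ne (min'_le _ _ hbm) hba.symm
        refine prod_eq_zero (hsub hmem) ?_
        rw [partFactor, if_pos hlt, if_neg]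
        exact (Multiset.count_pos.2 (Multiset.mem_toFinset.1 hmem)).ne'
      · exact hvan hb hbm
    · exact fun h => absurd (hsub hmem) h

end HigherSpt

/-! ### The generating function of the higher order spt-functions. -/

namespace HigherSpt

open Finset PowerSeries

/-- The power series `∑ c, g c * X ^ (i * c)`. -/
noncomputable def dilate {R : Type*} [CommSemiring R] (i : ℕ) (g : ℕ → R) : R⟦X⟧ :=
  mk fun e => if i ∣ e then g (e / i) else 0

lemma dilate_eq_expand {R : Type*} [CommRing R] {i : ℕ} (hi : i ≠ 0) (g : ℕ → R) :
    dilate i g = expand i hi (mk g) := by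
  ext e
  rw [dilate, coeff_mk, coeff_expand]
  simp only [coeff_mk]

lemma dilate_ite (R : Type*) [CommSemiring R] (i : ℕ) :
    dilate i (fun c => if c = 0 then (1 : R) else 0) = 1 := by
  ext e
  rw [dilate, coeff_mk, coeff_one]
  by_cases he : e = 0
  · simp [he]
  · rw [if_neg he]
    split_ifs with h1 h2
    · exact absurd (Nat.eq_zero_of_dvd_of_div_eq_zero h1 h2) he
    · rfl
    · rfl

/-- The generating function of partitions weighted multiplicatively by the multiplicities of
the parts. -/
lemma coeff_prod_dilate {R : Type*} [CommSemiring R] (f : ℕ → ℕ → R) {n N : ℕ} (hn : n ≤ N) :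
    coeff n (∏ i ∈ Icc 1 N, dilate i (f i)) =
      ∑ π : n.Partition, ∏ i ∈ Icc 1 N, f i (π.parts.count i) := by
  rw [coeff_prod]
  symm
  refine sum_of_injOn Nat.Partition.toFinsuppAntidiag
    (Nat.Partition.toFinsuppAntidiag_injective n).injOn ?_ ?_ ?_
  · intro π _
    exact mem_of_subset (finsuppAntidiag_mono (Icc_subset_Icc_right hn) _)
      π.toFinsuppAntidiag_mem_finsuppAntidiag
  · intro g hg hg'
    by_contra hne
    rw [mem_finsuppAntidiag] at hg
    have hdvd (i : ℕ) : i ∣ g i := by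
      by_cases hi : i ∈ Icc 1 N
      · by_contra hd
        refine hne (prod_eq_zero hi ?_)
        rw [dilate, coeff_mk, if_neg hd]
      · rw [Finsupp.notMem_support_iff.1 fun h => hi (hg.2 h)]
        exact dvd_zero i
    have hpos {i : ℕ} (hi : g i ≠ 0) : 0 < i :=
      (mem_Icc.1 (hg.2 (Finsupp.mem_support_iff.2 hi))).1
    refine hg' ⟨⟨(Finsupp.mk g.support (fun i => g i / i) ?_).toMultiset, ?_, ?_⟩,
      mem_coe.2 (mem_univ _), ?_⟩
    · intro i
      rw [Finsupp.mem_support_iff]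
      refine not_congr ⟨fun h => by rw [h, Nat.zero_div], fun h => ?_⟩
      exact Nat.eq_zero_of_dvd_of_div_eq_zero (hdvd i) h
    · intro i hi
      rw [Finsupp.mem_toMultiset] at hi
      exact hpos (Finsupp.mem_support_iff.1 hi)
    · refine Eq.trans ?_ hg.1
      have h : ∑ x ∈ g.support, g x / x * x = ∑ x ∈ Icc 1 N, g x := by
        rw [← sum_subset hg.2 fun x _ hx => Finsupp.notMem_support_iff.1 hx]
        exact sum_congr rfl fun x _ => Nat.div_mul_cancel (hdvd x)
      simpa [Finsupp.sum] using h
    · ext i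
      simpa [Nat.Partition.toFinsuppAntidiag] using Nat.div_mul_cancel (hdvd i)
  · intro π _
    refine prod_congr rfl fun i hi => ?_
    have : 0 < i := (mem_Icc.1 hi).1
    simp [dilate, Nat.Partition.toFinsuppAntidiag, this]

/-- Interchange of the two variables of an iterated power series. -/
noncomputable def swapVars (R : Type*) [CommSemiring R] : R⟦X⟧⟦X⟧ →+* R⟦X⟧⟦X⟧ where
  toFun F := mk fun m => mk fun n => coeff m (coeff n F)
  map_one' := by
    ext m n
    simp only [coeff_mk, coeff_one]
    split_ifs <;> simp_all [coeff_one]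
  map_zero' := by ext m n; simp
  map_add' F G := by ext m n; simp
  map_mul' F G := by
    ext m n
    simp only [coeff_mk, coeff_mul, map_sum]
    exact sum_comm

lemma coeff_coeff_swapVars {R : Type*} [CommSemiring R] (F : R⟦X⟧⟦X⟧) (m n : ℕ) :
    coeff n (coeff m (swapVars R F)) = coeff m (coeff n F) := by
  simp [swapVars]

lemma swapVars_X (R : Type*) [CommSemiring R] : swapVars R X = C X := by
  ext m n
  rw [coeff_coeff_swapVars, coeff_X, coeff_C]
  split_ifs <;> simp_all [coeff_X, coeff_one]

lemma swapVars_C_X (R : Type*) [CommSemiring R] : swapVars R (C X) = X := by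
  ext m n
  rw [coeff_coeff_swapVars, coeff_X, coeff_C]
  split_ifs <;> simp_all [coeff_X, coeff_one]

/-- The binomial weights, as polynomials in the marking variable `u`, obey this Chebyshev-type
recurrence in the multiplicity `c`, so their generating functions are rational. -/
lemma mk_mul_eq_of_recurrence {R : Type*} [CommRing R] (u a b : R) (f : ℕ → R) (h0 : f 0 = a)
    (h1 : f 1 = (2 + u) * a + b) (h : ∀ c, f (c + 2) = (2 + u) * f (c + 1) - f c) :
    mk f * ((1 - X) ^ 2 - C u * X) = C a + C b * X := by
  have e : PowerSeries.mk f * ((1 - X) ^ 2 - C u * X) =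
      PowerSeries.mk f - C (2 + u) * PowerSeries.mk f * X + PowerSeries.mk f * X * X := by
    rw [map_add, map_ofNat]
    ring
  rw [e]
  ext c
  rcases c with - | - | c
  · simp [h0]
  · rw [map_add, map_sub, coeff_succ_mul_X, coeff_succ_mul_X, coeff_C_mul, map_add,
      coeff_succ_mul_X]
    simp [h0, h1, coeff_C]
  · rw [map_add, map_sub, coeff_succ_mul_X, coeff_succ_mul_X, coeff_succ_mul_X, coeff_C_mul,
      map_add, coeff_succ_mul_X]
    simp [h]

lemma mk_otherFactor_mul (R : Type*) [CommRing R] :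
    (mk fun c => mk fun m => (otherFactor c m : R)) * ((1 - X) ^ 2 - C X * X) = 1 - X := by
  rw [mk_mul_eq_of_recurrence X 1 (-1) _ (mk_otherFactor_zero R)]
  · simp [sub_eq_add_neg]
  · rw [← map_ofNat C 2]
    ext m
    rcases m with - | - | m
    · simp [otherFactor]
      norm_num
    · simp [otherFactor, coeff_X, coeff_one]
    · rw [coeff_mk, otherFactor, Nat.choose_eq_zero_of_lt (by omega)]
      simp [coeff_X, coeff_one]
  · intro c
    rw [add_mul]
    ext m
    rw [map_sub, map_add, mul_comm X, ← map_ofNat C 2, coeff_C_mul]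
    rcases m with - | m
    · simp [otherFactor]
      norm_num
    · rw [coeff_succ_mul_X]
      simp only [coeff_mk, otherFactor]
      have h1 : (c + 2 + (m + 1)).choose (2 * (m + 1)) =
          (c + m + 2).choose (2 * m + 1) + (c + m + 2).choose (2 * m + 2) := by
        rw [← Nat.choose_succ_succ']; congr 1; ring
      have h2 : (c + m + 2).choose (2 * m + 1) =
          (c + m + 1).choose (2 * m) + (c + m + 1).choose (2 * m + 1) := Nat.choose_succ_succ' _ _
      have h3 : (c + m + 2).choose (2 * m + 2) =
          (c + m + 1).choose (2 * m + 1) + (c + m + 1).choose (2 * m + 2) :=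
        Nat.choose_succ_succ' _ _
      rw [h1, show c + 1 + (m + 1) = c + m + 2 by ring, show 2 * (m + 1) = 2 * m + 2 by ring,
        show c + (m + 1) = c + m + 1 by ring, show c + 1 + m = c + m + 1 by ring, h2, h3]
      push_cast
      ring

lemma mk_smallestFactor_mul (R : Type*) [CommRing R] :
    (mk fun c => mk fun m => (smallestFactor c m : R)) * ((1 - X) ^ 2 - C X * X) = C X * X := by
  rw [mk_mul_eq_of_recurrence X 0 X _ (mk_smallestFactor_zero R)]
  · simp
  · ext m
    rcases m with - | - | m
    · simp [smallestFactor]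
    · simp [smallestFactor, coeff_X]
    · rw [coeff_mk, smallestFactor_of_ne_zero _ (by omega), Nat.choose_eq_zero_of_lt (by omega)]
      simp [coeff_X]
  · intro c
    rw [add_mul]
    ext m
    rw [map_sub, map_add, mul_comm X, ← map_ofNat C 2, coeff_C_mul]
    rcases m with - | - | m
    · simp [smallestFactor]
    · rw [coeff_succ_mul_X]
      simp [smallestFactor]
      ring
    · rw [coeff_succ_mul_X]
      simp only [coeff_mk]
      rw [smallestFactor_of_ne_zero _ (by omega), smallestFactor_of_ne_zero _ (by omega),
        smallestFactor_of_ne_zero _ (by omega), smallestFactor_of_ne_zero _ (by omega)]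
      have h1 : (c + m + 3).choose (2 * m + 3) =
          (c + m + 2).choose (2 * m + 2) + (c + m + 2).choose (2 * m + 3) :=
        Nat.choose_succ_succ' _ _
      have h2 : (c + m + 2).choose (2 * m + 2) =
          (c + m + 1).choose (2 * m + 1) + (c + m + 1).choose (2 * m + 2) :=
        Nat.choose_succ_succ' _ _
      have h3 : (c + m + 2).choose (2 * m + 3) =
          (c + m + 1).choose (2 * m + 2) + (c + m + 1).choose (2 * m + 3) :=
        Nat.choose_succ_succ' _ _
      rw [show c + 2 + (m + 1 + 1) - 1 = c + m + 3 by omega,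
        show 2 * (m + 1 + 1) - 1 = 2 * m + 3 by omega,
        show c + 1 + (m + 1 + 1) - 1 = c + m + 2 by omega,
        show c + (m + 1 + 1) - 1 = c + m + 1 by omega,
        show c + 1 + (m + 1) - 1 = c + m + 1 by omega,
        show 2 * (m + 1) - 1 = 2 * m + 1 by omega, h1, h2, h3]
      push_cast
      ring

lemma swapVars_dilate_mul {R : Type*} [CommRing R] {i : ℕ} (hi : i ≠ 0) {g : ℕ → R⟦X⟧}
    {r : R⟦X⟧⟦X⟧} (h : mk g * ((1 - X) ^ 2 - C X * X) = r) :
    swapVars R (dilate i g) * (C ((1 - X ^ i) ^ 2) - X * C (X ^ i)) =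
      swapVars R (expand i hi r) := by
  rw [← h, dilate_eq_expand hi, map_mul (expand i hi), map_mul (swapVars R)]
  congr 1
  simp only [map_sub, map_mul, map_pow, map_one, expand_X, expand_C, swapVars_X, swapVars_C_X]

/-- With `y = q^i`, `(1 - y) / ((1 - y)^2 - u y)` factors as `1 / (1 - y)` times `1 / (1 - u y / (1
- y)^2)`. -/
lemma swapVars_dilate_otherFactor {i : ℕ} (hi : i ≠ 0) :
    swapVars (ZMod 3) (dilate i fun c => mk fun m => (otherFactor c m : ZMod 3)) =
      C (geomQ i) * geom (lam i) := by
  have h := swapVars_dilate_mul hi (mk_otherFactor_mul (ZMod 3))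
  simp only [map_sub, map_one, expand_X, map_pow, swapVars_X] at h
  have hg := congrArg (C (R := (ZMod 3)⟦X⟧)) (geomQ_mul hi)
  have hl := geom_mul (lam i)
  simp only [lam, map_mul, map_pow, map_sub, map_one] at hg hl ⊢
  generalize geom (X ^ i * geomQ i ^ 2) = G at *
  generalize C (geomQ i) = Q at *
  generalize (C X : (ZMod 3)⟦X⟧⟦X⟧) ^ i = Z at *
  generalize swapVars (ZMod 3) (dilate i fun c => mk fun m => (otherFactor c m : ZMod 3)) = S at *
  linear_combination -S * hl + G * Q ^ 2 * h + (G * Q - S * G * (Q * (1 - Z) + 1)) * hg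

lemma swapVars_dilate_smallestFactor {i : ℕ} (hi : i ≠ 0) :
    swapVars (ZMod 3) (dilate i fun c => mk fun m => (smallestFactor c m : ZMod 3)) =
      X * C (lam i) * geom (lam i) := by
  have h := swapVars_dilate_mul hi (mk_smallestFactor_mul (ZMod 3))
  simp only [map_mul, expand_C, expand_X, map_pow, swapVars_X, swapVars_C_X] at h
  have hg := congrArg (C (R := (ZMod 3)⟦X⟧)) (geomQ_mul hi)
  have hl := geom_mul (lam i)
  simp only [lam, map_mul, map_pow, map_sub, map_one] at hg hl h ⊢
  generalize geom (X ^ i * geomQ i ^ 2) = G at *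
  generalize C (geomQ i) = Q at *
  generalize (C X : (ZMod 3)⟦X⟧⟦X⟧) ^ i = Z at *
  generalize swapVars (ZMod 3) (dilate i fun c => mk fun m => (smallestFactor c m : ZMod 3)) = S at *
  linear_combination -S * hl + G * Q ^ 2 * h - S * G * (Q * (1 - Z) + 1) * hg

lemma prod_geomQ {a N : ℕ} (ha : a ≤ N) :
    ∏ i ∈ Ioc a N, geomQ i = (qPoch X X N)⁻¹ * qPoch X X a := by
  have h : qPoch X X a * ∏ i ∈ Ioc a N, (1 - X ^ i) = (qPoch X X N : (ZMod 3)⟦X⟧) := by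
    have hd : Disjoint (Icc 1 a) (Ioc a N) :=
      disjoint_left.2 fun x h1 h2 => by simp only [mem_Icc, mem_Ioc] at h1 h2; omega
    rw [qPoch_eq_prod, qPoch_eq_prod, ← prod_union hd]
    congr 1
    ext x
    simp only [mem_union, mem_Icc, mem_Ioc]
    omega
  have h1 : (∏ i ∈ Ioc a N, geomQ i) * ∏ i ∈ Ioc a N, (1 - X ^ i) = 1 := by
    rw [← prod_mul_distrib]
    refine prod_eq_one fun i hi => geomQ_mul ?_
    simp only [mem_Ioc] at hi
    omega
  have h2 : (qPoch X X N)⁻¹ * qPoch X X N = (1 : (ZMod 3)⟦X⟧) :=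
    PowerSeries.inv_mul_cancel _
      (PowerSeries.isUnit_iff_constantCoeff.1 (isUnit_qPoch N)).ne_zero
  linear_combination (-∏ i ∈ Ioc a N, geomQ i) * h2 + (qPoch X X N)⁻¹ * qPoch X X a * h1 -
    (qPoch X X N)⁻¹ * (∏ i ∈ Ioc a N, geomQ i) * h

lemma swapVars_prod_dilate_partFactor {a N : ℕ} (ha : 1 ≤ a) (haN : a ≤ N) :
    swapVars (ZMod 3) (∏ i ∈ Icc 1 N, dilate i (partFactor (ZMod 3) a i)) =
      C ((qPoch X X N)⁻¹ * (qPoch X X a * lam a)) * (X * ∏ i ∈ Icc a N, geom (lam i)) := by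
  have hsmall (i : ℕ) (hi : i < a) : dilate i (partFactor (ZMod 3) a i) = 1 := by
    rw [← dilate_ite _ i]
    congr 1
    funext c
    rw [partFactor, if_pos hi]
  have hI : Icc a N = insert a (Ioc a N) := (Ioc_insert_left haN).symm
  rw [← prod_subset (Icc_subset_Icc_left ha) fun i hi hi' => hsmall i ?_]
  · rw [hI, prod_insert left_notMem_Ioc, prod_insert left_notMem_Ioc, map_mul, map_prod]
    have h1 : dilate a (partFactor (ZMod 3) a a) =
        dilate a fun c => PowerSeries.mk fun m => (smallestFactor c m : ZMod 3) := by
      congr 1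
      funext c
      rw [partFactor, if_neg (lt_irrefl a), if_pos rfl]
    have h2 : ∏ i ∈ Ioc a N, swapVars (ZMod 3) (dilate i (partFactor (ZMod 3) a i)) =
        ∏ i ∈ Ioc a N, C (geomQ i) * geom (lam i) := by
      refine prod_congr rfl fun i hi => ?_
      rw [mem_Ioc] at hi
      rw [← swapVars_dilate_otherFactor (by omega)]
      congr 2
      funext c
      rw [partFactor, if_neg (by omega), if_neg (by omega)]
    rw [h1, h2, swapVars_dilate_smallestFactor (by omega), prod_mul_distrib, ← map_prod,
      prod_geomQ haN]
    simp only [map_mul]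
    ring
  · simp only [mem_Icc] at hi hi'
    omega

/-- The generating function of `spt_k` modulo `3`, up to the order `N`. -/
lemma spt_eq_coeff {k n N : ℕ} (hn : n ≤ N) : (spt (k + 1) n : ZMod 3) =
    coeff n ((qPoch X X N)⁻¹ *
      ∑ a ∈ Icc 1 N, qPoch X X a * lam a * hsymm lam (Icc a N) k) := by
  rw [spt, Nat.cast_sum, sum_congr rfl fun π _ =>
    weight_eq_coeff_sum (k.succ_ne_zero) hn π (ZMod 3), ← map_sum, sum_comm,
    sum_congr rfl fun a _ => (coeff_prod_dilate (partFactor (ZMod 3) a) hn).symm, ← map_sum,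
    ← coeff_coeff_swapVars, map_sum (swapVars _), mul_sum, map_sum (coeff _)]
  congr 1
  refine sum_congr rfl fun a ha => ?_
  rw [mem_Icc] at ha
  -- The marked smallest part contributes one factor of the marking variable, which lowers the
  -- degree from `k + 1` to `k`.
  rw [swapVars_prod_dilate_partFactor ha.1 ha.2, coeff_C_mul, mul_comm X, coeff_succ_mul_X, hsymm,
    mul_assoc]

end HigherSpt

theorem mainTheorem10 (n : ℕ) : HigherSpt.spt 4 (3 * n) ≡ 0 [MOD 3] := by
  -- The truncation order `3 * n + 1` stays positive when `n = 0` and still determines the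
  -- coefficient of index `3 * n`.
  obtain ⟨G, hG⟩ := HigherSpt.modX_exists_eulerD (N := 3 * n + 1) (Nat.le_add_left 1 _)
  rw [Nat.modEq_zero_iff_dvd, ← ZMod.natCast_eq_zero_iff,
    HigherSpt.spt_eq_coeff (Nat.le_succ (3 * n)),
    HigherSpt.coeff_eq_of_modX_eq hG (by omega), HigherSpt.coeff_eulerD, Nat.cast_mul,
    CharP.cast_eq_zero (ZMod 3) 3, zero_mul, zero_mul]
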